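/- **Theorem (invertible 2-knots have $\tau\equiv 0$).** A \emph{2-knot} is a smoothly embedded 2-sphere $F\subset\mathbb{R}^4$. Two oriented 2-knots are \emph{equivalent} if a smooth ambient isotopy of $\mathbb{R}^4$ carries one to the other preserving orientations; $-F$ denotes $F$ with the opposite orientation, and $F$ is \emph{invertible} if the oriented 2-knots $F$ and $-F$ are equivalent. Let $G=\pi_1(\mathbb{R}^4\setminus F)$, and let $\mathbb{Z}[t^{\pm1}]$ act on $G'/G''$ by letting $t$ act as conjugation by a positively oriented meridian of $F$ (this module is the first homology of the infinite cyclic covering of the complement). The \emph{Alexander polynomial} $\Delta_F(t)=\sum_{k\in\mathbb{Z}}a_kt^k\in\mathbb{Z}[t^{\pm1}]$ is a greatest common divisor of the order ideal (zeroth Fitting ideal) of this module; it is determined up to multiplication by $\pm t^n$, $n\in\mathbb{Z}$. Put $$a(F)=\sum_{k\in\mathbb{Z}}|a_k|,\qquad \tau(F)=\sum_{k\in\mathbb{Z}}k\,|a_k| \pmod{a(F)} .$$ If $F$ is an invertible oriented 2-knot, then $\tau(F)\equiv 0 \pmod{a(F)}$ (for every choice of the Alexander polynomial $\Delta_F$).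 -/

import Mathlib

open scoped Manifold ContDiff LaurentPolynomial

noncomputable section

/-! ### Oriented smooth 2-knots in `ℝ⁴` -/

/-- Euclidean 4-space. -/
abbrev R4 : Type := EuclideanSpace ℝ (Fin 4)

/-- The unit 2-sphere in Euclidean 3-space, with its standard smooth structure. -/
abbrev S2 : Type := Metric.sphere (0 : EuclideanSpace ℝ (Fin 3)) 1

/-- The value of the standard area form of the unit sphere on two tangent vectors at `s`: the
determinant of `(s, u, v)` in `ℝ³`, with `u`, `v` seen in `ℝ³` through the inclusion `S² → ℝ³`. -/
def sphereDet (s : S2) (u v : TangentSpace (𝓡 2) s) : ℝ :=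
  Matrix.det (Matrix.of
    ![(s : EuclideanSpace ℝ (Fin 3)).ofLp,
      (mfderiv (𝓡 2) 𝓘(ℝ, EuclideanSpace ℝ (Fin 3))
        (Subtype.val : S2 → EuclideanSpace ℝ (Fin 3)) s u : EuclideanSpace ℝ (Fin 3)).ofLp,
      (mfderiv (𝓡 2) 𝓘(ℝ, EuclideanSpace ℝ (Fin 3))
        (Subtype.val : S2 → EuclideanSpace ℝ (Fin 3)) s v : EuclideanSpace ℝ (Fin 3)).ofLp])

/-- The determinant of four vectors of `ℝ⁴`. -/
def det4 (a b c d : R4) : ℝ := Matrix.det (Matrix.of ![a.ofLp, b.ofLp, c.ofLp, d.ofLp])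

/-- An oriented 2-knot: a smoothly embedded 2-sphere in `ℝ⁴` together with one of its two
orientations. The orientation is recorded as a sign relative to the standard orientation of the
parametrizing sphere. -/
structure TwoKnot where
  /-- the embedding -/
  toFun : S2 → R4
  isSmoothEmbedding : Manifold.IsSmoothEmbedding (𝓡 2) 𝓘(ℝ, R4) ∞ toFun
  /-- the orientation: `1` for the standard one of `S²`, `-1` for the opposite one -/
  sign : ℤˣ

/-- A smooth ambient isotopy of `ℝ⁴`: a smooth family of diffeomorphisms starting at the identity;
the part over `t ∈ [0, 1]` is the one that is used. -/
structure AmbientIsotopy where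
  /-- the diffeomorphism at time `t` -/
  map : ℝ → (R4 ≃ₘ^∞⟮𝓘(ℝ, R4), 𝓘(ℝ, R4)⟯ R4)
  contDiff : ContDiff ℝ ∞ (fun q : ℝ × R4 => map q.1 q.2)
  map_zero : ∀ y, map 0 y = y

namespace TwoKnot

/-- `(u, v)` is a positively oriented basis of the tangent plane at the point with parameter `s`. -/
def IsPositiveBasis (F : TwoKnot) (s : S2) (u v : TangentSpace (𝓡 2) s) : Prop :=
  0 < ((F.sign : ℤ) : ℝ) * sphereDet s u v

/-- `-F`: the same embedded sphere with the opposite orientation. -/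
def reverse (F : TwoKnot) : TwoKnot where
  toFun := F.toFun
  isSmoothEmbedding := F.isSmoothEmbedding
  sign := -F.sign

/-- Equivalence of oriented 2-knots: a smooth ambient isotopy of `ℝ⁴` whose final diffeomorphism
carries `F` onto `G` and the orientation of `F` to that of `G`. The diffeomorphism `φ` of the
sphere is the change of parametrization. -/
def Equivalent (F G : TwoKnot) : Prop :=
  ∃ (H : AmbientIsotopy) (φ : S2 ≃ₘ^∞⟮𝓡 2, 𝓡 2⟯ S2),
    (∀ s, H.map 1 (F.toFun s) = G.toFun (φ s)) ∧
    ∀ (s : S2) (u v : TangentSpace (𝓡 2) s), F.IsPositiveBasis s u v →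
      G.IsPositiveBasis (φ s) (mfderiv (𝓡 2) (𝓡 2) φ s u) (mfderiv (𝓡 2) (𝓡 2) φ s v)

/-- A 2-knot is invertible if it is equivalent, as an oriented 2-knot, to its reverse. -/
def IsInvertible (F : TwoKnot) : Prop := F.Equivalent F.reverse

/-! ### The knot group and meridians -/

/-- The complement of the 2-knot in `ℝ⁴`. -/
abbrev Complement (F : TwoKnot) : Type := {y : R4 // y ∉ Set.range F.toFun}

/-- A positive meridian disk: a smooth disk (the restriction of `toFun` to the closed unit disk
of `ℂ`) that meets `F` only at its centre, transversely and with intersection number `+1` there: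
an oriented basis of the tangent plane of `F`, followed by the oriented basis of the
disk, is an oriented basis of `ℝ⁴`. -/
structure MeridianDisk (F : TwoKnot) where
  /-- the disk -/
  toFun : ℂ → R4
  contDiff : ContDiff ℝ ∞ toFun
  /-- the parameter of the intersection point -/
  center : S2
  map_zero : toFun 0 = F.toFun center
  notMem : ∀ z : ℂ, ‖z‖ ≤ 1 → z ≠ 0 → toFun z ∉ Set.range F.toFun
  positive : ∀ u v : TangentSpace (𝓡 2) center, F.IsPositiveBasis center u v →
    0 < det4 (mfderiv (𝓡 2) 𝓘(ℝ, R4) F.toFun center u) (mfderiv (𝓡 2) 𝓘(ℝ, R4) F.toFun center v)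
      (fderiv ℝ toFun 0 1) (fderiv ℝ toFun 0 Complex.I)

/-- The boundary of a meridian disk at the angle `θ`, as a point of the complement. -/
def MeridianDisk.boundaryPoint {F : TwoKnot} (D : F.MeridianDisk) (θ : ℝ) : F.Complement :=
  ⟨D.toFun (Circle.exp θ : ℂ), D.notMem _ (by simp) (by simp)⟩

/-- The oriented boundary loop of a meridian disk, in the complement. -/
def MeridianDisk.boundary {F : TwoKnot} (D : F.MeridianDisk) :
    Path (D.boundaryPoint 0) (D.boundaryPoint 0) where
  toFun t := D.boundaryPoint (2 * Real.pi * (t : ℝ))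
  continuous_toFun := by
    refine Continuous.subtype_mk (D.contDiff.continuous.comp ?_) _
    fun_prop
  source' := by simp
  target' := by
    apply Subtype.ext
    simp [boundaryPoint]

/-- `μ` is a positive meridian of `F`: the class of the boundary loop of a positive meridian disk,
joined to the base point by a path in the complement. -/
def IsMeridian (F : TwoKnot) (x : F.Complement) (μ : FundamentalGroup F.Complement x) : Prop :=
  ∃ (D : F.MeridianDisk) (γ : Path x (D.boundaryPoint 0)),
    μ = FundamentalGroup.fromPath (Path.Homotopic.Quotient.mk (γ.trans (D.boundary.trans γ.symm)))

end TwoKnot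

/-! ### The Alexander module and the Alexander polynomial -/

section Alexander

variable {G : Type} [Group G]

/-- The abelian group `G' / G''`, on which the variable `t` is going to act through conjugation
by `μ`. For `G` a knot group and `μ` a meridian this is the first homology of the infinite cyclic
covering of the knot complement. -/
def AlexanderModule (_μ : G) : Type := Additive (Abelianization (commutator G))

instance (μ : G) : AddCommGroup (AlexanderModule μ) :=
  inferInstanceAs (AddCommGroup (Additive (Abelianization (commutator G))))

/-- The action of `G` on `G' / G''` by conjugation: `g` acts as `[h] ↦ [g h g⁻¹]`. -/
def conjHom (μ : G) : G →* AddMonoid.End (AlexanderModule μ) where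
  toFun g := (MonoidHom.toAdditive
    (Abelianization.map (MulAut.conjNormal (H := commutator G) g).toMonoidHom) :
      Additive (Abelianization (commutator G)) →+ Additive (Abelianization (commutator G)))
  map_one' := by
    rw [map_one]
    change MonoidHom.toAdditive (Abelianization.map (MonoidHom.id (commutator G))) = _
    rw [Abelianization.map_id]
    rfl
  map_mul' a b := by
    rw [map_mul]
    change MonoidHom.toAdditive (Abelianization.map
      ((MulAut.conjNormal (H := commutator G) a).toMonoidHom.comp
        (MulAut.conjNormal (H := commutator G) b).toMonoidHom)) = _
    rw [← Abelianization.map_comp]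
    rfl

/-- The ring homomorphism `ℤ[t, t⁻¹] → End(G' / G'')` that sends `t` to `[h] ↦ [μ⁻¹ * h * μ]`.
In Mathlib's fundamental group `p * q` is the loop that runs first through `q` and then through `p`,
so for a loop `h` in a knot complement `μ⁻¹ * h * μ` is the loop that runs through `μ`, then `h`,
then `μ` backwards: `t` is the translation of the infinite cyclic covering given by `μ`. -/
def alexanderAction (μ : G) : ℤ[T;T⁻¹] →+* AddMonoid.End (AlexanderModule μ) :=
  (AddMonoidAlgebra.lift ℤ (AddMonoid.End (AlexanderModule μ)) ℤ
    ((conjHom μ).comp (zpowersHom G μ⁻¹))).toRingHom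

/-- The Alexander module `G' / G''` as a module over `ℤ[t, t⁻¹]`. -/
instance (μ : G) : Module ℤ[T;T⁻¹] (AlexanderModule μ) :=
  Module.compHom _ (alexanderAction μ)

end Alexander

/-- The order ideal (the zeroth Fitting ideal) of a module: it is generated by the determinants of
all square matrices of relations between finite families of generators. -/
def orderIdeal (R M : Type*) [CommRing R] [AddCommGroup M] [Module R M] : Ideal R :=
  Ideal.span {d | ∃ (n : ℕ) (g : Fin n → M) (A : Matrix (Fin n) (Fin n) R),
    Submodule.span R (Set.range g) = ⊤ ∧ (∀ i, ∑ j, A i j • g j = 0) ∧ d = A.det}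

/-- `d` is a greatest common divisor of the elements of the ideal `I`. -/
def IsIdealGCD {R : Type*} [CommRing R] (I : Ideal R) (d : R) : Prop :=
  (∀ e ∈ I, d ∣ e) ∧ ∀ d', (∀ e ∈ I, d' ∣ e) → d' ∣ d

/-- `Δ` is an Alexander polynomial of the oriented 2-knot `F`: a greatest common divisor of the
order ideal of the Alexander module of the knot group, where `t` is given by a positive meridian.
It is determined up to multiplication by a unit `± t ^ n`. -/
def TwoKnot.IsAlexanderPolynomial (F : TwoKnot) (Δ : ℤ[T;T⁻¹]) : Prop :=
  ∃ (x : F.Complement) (μ : FundamentalGroup F.Complement x), F.IsMeridian x μ ∧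
    IsIdealGCD (orderIdeal ℤ[T;T⁻¹] (AlexanderModule μ)) Δ

/-- The number `a = ∑ |a_k|` for `Δ = ∑ a_k t ^ k`. -/
def aInvariant (Δ : ℤ[T;T⁻¹]) : ℕ := ∑ k ∈ Δ.coeff.support, (Δ.coeff k).natAbs

/-- The class `τ` of `∑ k |a_k|` modulo `a = ∑ |a_k|`, for `Δ = ∑ a_k t ^ k`. -/
def tauInvariant (Δ : ℤ[T;T⁻¹]) : ZMod (aInvariant Δ) :=
  ((∑ k ∈ Δ.coeff.support, k * |Δ.coeff k| : ℤ) : ZMod (aInvariant Δ))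

end

/-! Write `G` for the knot group, `μ` for a positive meridian and `M` for `G' / G''`. The end of an
isotopy from `F` to `-F` restricts to a homeomorphism of the complement. Together with a path back
to the base point it induces a surjective endomorphism `σ` of `G` with `σ μ = μ⁻¹` in `G / G'`.
Conjugation on `M` depends only on the class in `G / G'`, so `σ` acts on `M` as a surjection that is
semilinear for `t ↦ t⁻¹`. Hence the order ideal is stable under `t ↦ t⁻¹` (`invert_mem_orderIdeal`),
and its greatest common divisor satisfies `Δ(t⁻¹) = ± tⁿ Δ(t)`. Thus `|a_k| = |a_{-n-k}|`, and the
substitution `k ↦ -n - k` gives `2 τ ≡ 0` modulo `a`.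

The factor `2` can be cancelled because `a` is odd: `a ≡ Δ(1)` modulo `2`, and `Δ(1) = ± 1`. Indeed
`μ` generates `G / G'`, so `t - 1` maps `M` onto itself. If `M` is finitely generated, Nakayama's
lemma gives an element of the order ideal with value `1` at `t = 1`
(`exists_mem_orderIdeal_evalOne`). If it is not, the order ideal and `Δ` are zero and nothing is
left to prove.

The topological input is that `μ` generates `G / G'` and that all positive meridians agree there.
Homology is replaced by cocycles on paths with values in an abelian group; `PathCocycle.hurewicz` is
the tautological one, with values in `G / G'`. In a tubular chart, logarithmic coordinates show that
all meridian disks have the same value, and connectedness of the sphere makes this value global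
(`TwoKnot.val_boundary_eq`). A cocycle vanishing on a meridian is a coboundary near every point of
`ℝ⁴`. These local potentials glue, since a knot of codimension two does not disconnect convex open
sets, so the cocycle vanishes on all loops (`TwoKnot.val_loop_eq_zero`). Applied to `G / G'` modulo
`μ`, this gives generation. Finally, an isotopy has differentials of positive determinant, so it
carries a positive meridian disk of `F` to one of `-F`; conjugating the parameter makes it positive
for `F` and reverses its boundary. -/

noncomputable section

open Topology

/-! ### Laurent polynomials over `ℤ` -/

/-- The value of an integral Laurent polynomial at `1`. -/
def evalOne : ℤ[T;T⁻¹] →+* ℤ := LaurentPolynomial.eval₂ (RingHom.id ℤ) 1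

theorem evalOne_T (n : ℤ) : evalOne (LaurentPolynomial.T n) = 1 := by
  simp [evalOne]

theorem evalOne_C_mul_T (a n : ℤ) :
    evalOne (LaurentPolynomial.C a * LaurentPolynomial.T n) = a := by
  simp [evalOne]

theorem evalOne_eq_sum (p : ℤ[T;T⁻¹]) : evalOne p = ∑ k ∈ p.coeff.support, p.coeff k := by
  change evalOne p = p.coeff.sum fun _ a => a
  induction p using LaurentPolynomial.induction_on' with
  | add p q hp hq =>
    rw [map_add, hp, hq, AddMonoidAlgebra.coeff_add, Finsupp.sum_add_index'] <;> simp
  | C_mul_T n a =>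
    rw [evalOne_C_mul_T, ← LaurentPolynomial.single_eq_C_mul_T, AddMonoidAlgebra.coeff_single,
      Finsupp.sum_single_index rfl]

/-- The units of `ℤ[t, t⁻¹]` are `± tⁿ`. -/
theorem LaurentPolynomial.exists_eq_of_isUnit {u : ℤ[T;T⁻¹]} (hu : IsUnit u) :
    ∃ (ε : ℤ) (n : ℤ), |ε| = 1 ∧ u = C ε * T n := by
  obtain ⟨v, hv⟩ := hu.exists_right_inv
  obtain ⟨n, p, hp⟩ := exists_T_pow u
  obtain ⟨m, q, hq⟩ := exists_T_pow v
  -- After clearing denominators, two polynomials multiply to a power of the prime `X`, so each is a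
  -- constant unit times a power of `X`.
  have hpq : p * q = Polynomial.X ^ (n + m) := by
    apply Polynomial.toLaurent_injective
    rw [map_mul, hp, hq, Polynomial.toLaurent_X_pow, Nat.cast_add, T_add]
    linear_combination (T (n : ℤ) * T (m : ℤ)) * hv
  obtain ⟨i, -, hi⟩ := (dvd_prime_pow Polynomial.prime_X _).1 (Dvd.intro _ hpq)
  obtain ⟨w, hw⟩ := hi.symm
  obtain ⟨r, hr, hrw⟩ := Polynomial.isUnit_iff.1 w.isUnit
  refine ⟨r, i - n, Int.isUnit_iff_abs_eq.1 hr, ?_⟩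
  have h2 : u * T n = C r * T i := by
    rw [← hp, ← hw, ← hrw, map_mul, Polynomial.toLaurent_X_pow, Polynomial.toLaurent_C, mul_comm]
  calc u = u * T n * T (-n) := by rw [mul_T_assoc]; simp
    _ = _ := by rw [h2, mul_T_assoc, sub_eq_add_neg]

theorem coeff_C_mul_T_mul (a n k : ℤ) (p : ℤ[T;T⁻¹]) :
    (LaurentPolynomial.C a * LaurentPolynomial.T n * p).coeff k = a * p.coeff (k - n) := by
  rw [← LaurentPolynomial.single_eq_C_mul_T, show k = n + (k - n) by ring]
  rw [AddMonoidAlgebra.coeff_single_mul_add]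
  simp

/-- A Laurent polynomial with odd value at `1` which is associated to its image under `t ↦ t⁻¹`
has trivial `τ`. -/
theorem tauInvariant_eq_zero_of_invert_eq {p : ℤ[T;T⁻¹]} (hodd : Odd (evalOne p))
    {ε n : ℤ} (hε : |ε| = 1)
    (h : LaurentPolynomial.invert p = LaurentPolynomial.C ε * LaurentPolynomial.T n * p) :
    tauInvariant p = 0 := by
  have hcoef : ∀ k, |p.coeff (-k)| = |p.coeff (k - n)| := fun k => by
    have := congrArg (fun q : ℤ[T;T⁻¹] => |q.coeff k|) h
    rwa [LaurentPolynomial.invert_apply, coeff_C_mul_T_mul, abs_mul, hε, one_mul] at this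
  have ha : ((aInvariant p : ℕ) : ℤ) = ∑ k ∈ p.coeff.support, |p.coeff k| := by
    simp [aInvariant]
  -- The involution `k ↦ -n - k` preserves the support and the absolute values of the coefficients.
  have hsum : ∑ k ∈ p.coeff.support, k * |p.coeff k| =
      ∑ k ∈ p.coeff.support, (-n - k) * |p.coeff k| := by
    refine Finset.sum_bij' (fun k _ => -n - k) (fun k _ => -n - k) ?_ ?_ ?_ ?_ ?_
    · intro k hk
      rw [Finsupp.mem_support_iff, ← abs_ne_zero] at hk ⊢
      have := hcoef (-k)
      rw [neg_neg] at this
      rwa [show -n - k = -k - n by ring, ← this]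
    · intro k hk
      rw [Finsupp.mem_support_iff, ← abs_ne_zero] at hk ⊢
      have := hcoef (-k)
      rw [neg_neg] at this
      rwa [show -n - k = -k - n by ring, ← this]
    · intro k _; ring
    · intro k _; ring
    · intro k _
      have := hcoef (-k)
      rw [neg_neg] at this
      rw [show -n - k = -k - n by ring, ← this]; ring
  -- Signs do not matter modulo `2`, so `∑ |a_k|` has the parity of `∑ a_k`, the value at `1`.
  have hodda : Odd ((aInvariant p : ℕ) : ℤ) := by
    rw [evalOne_eq_sum] at hodd
    rw [ha, ← Int.not_even_iff_odd, even_iff_two_dvd] at *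
    intro h2
    apply hodd
    rw [← Int.modEq_zero_iff_dvd] at h2 ⊢
    refine Int.ModEq.trans ?_ h2
    refine Int.ModEq.sum fun k _ => ?_
    rcases abs_choice (p.coeff k) with h | h <;> rw [h]
    rw [Int.modEq_iff_dvd]
    exact ⟨-p.coeff k, by ring⟩
  rw [tauInvariant, ZMod.intCast_zmod_eq_zero_iff_dvd]
  have h2 : 2 * ∑ k ∈ p.coeff.support, k * |p.coeff k| = (aInvariant p : ℤ) * (-n) := by
    rw [two_mul]
    nth_rewrite 2 [hsum]
    rw [← Finset.sum_add_distrib, ha, Finset.sum_mul]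
    exact Finset.sum_congr rfl fun k _ => by ring
  have hcop : IsCoprime ((aInvariant p : ℕ) : ℤ) 2 := by
    obtain ⟨m, hm⟩ := hodda
    exact ⟨1, -m, by rw [hm]; ring⟩
  exact hcop.dvd_of_dvd_mul_left ⟨_, h2⟩

/-! ### The Alexander module -/

section AlexanderModule

variable {G : Type} [Group G]

/-- The class in `G' / G''` of an element of `G'`. -/
def alexanderClass (μ : G) : commutator G →* Multiplicative (AlexanderModule μ) :=
  Abelianization.of

theorem alexanderClass_surjective (μ : G) (m : AlexanderModule μ) :
    ∃ h, m = (alexanderClass μ h).toAdd := by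
  obtain ⟨h, hh⟩ := QuotientGroup.mk_surjective (Additive.toMul m)
  exact ⟨h, hh.symm⟩

theorem conjHom_class (μ g : G) (h : commutator G) :
    conjHom μ g (alexanderClass μ h).toAdd =
      (alexanderClass μ (MulAut.conjNormal (H := commutator G) g h)).toAdd := rfl

/-- Conjugation by an element of `G'` is an inner automorphism of `G'`, hence trivial on its
abelianization. -/
theorem conjHom_eq_one_of_mem (μ : G) {g : G} (hg : g ∈ commutator G) : conjHom μ g = 1 := by
  ext m
  obtain ⟨h, rfl⟩ := alexanderClass_surjective μ m
  rw [conjHom_class]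
  have : MulAut.conjNormal (H := commutator G) g h = ⟨g, hg⟩ * h * ⟨g, hg⟩⁻¹ := by
    ext; simp
  have h2 : alexanderClass μ (⟨g, hg⟩ * h * ⟨g, hg⟩⁻¹) = alexanderClass μ h := by
    rw [map_mul (alexanderClass μ), map_mul (alexanderClass μ), map_inv (alexanderClass μ),
      mul_right_comm, mul_inv_cancel, one_mul]
  rw [this, h2]
  rfl

/-- The action factors through `G / G'`. This is why it is enough to know the image of a meridian up
to commutators. -/
theorem conjHom_eq_of_of_eq (μ : G) {g g' : G}
    (h : Abelianization.of g = Abelianization.of g') : conjHom μ g = conjHom μ g' := by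
  have h1 : g * g'⁻¹ ∈ commutator G := by
    rw [← Abelianization.ker_of G, MonoidHom.mem_ker, map_mul, h, map_inv, mul_inv_cancel]
  rw [show g = (g * g'⁻¹) * g' by group, map_mul, conjHom_eq_one_of_mem μ h1, one_mul]

theorem alexander_smul_def (μ : G) (p : ℤ[T;T⁻¹]) (m : AlexanderModule μ) :
    p • m = alexanderAction μ p m := rfl

theorem T_smul (μ : G) (n : ℤ) (m : AlexanderModule μ) :
    (LaurentPolynomial.T n : ℤ[T;T⁻¹]) • m = conjHom μ (μ⁻¹ ^ n) m := by
  rw [alexander_smul_def]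
  have h : alexanderAction μ (.single n 1) = conjHom μ (μ⁻¹ ^ n) := by
    simp only [alexanderAction, AlgHom.toRingHom_eq_coe, RingHom.coe_coe,
      AddMonoidAlgebra.lift_single, one_smul]
    rfl
  exact congrArg (fun f : AddMonoid.End (AlexanderModule μ) => f m) h

theorem C_smul (μ : G) (a : ℤ) (m : AlexanderModule μ) :
    (LaurentPolynomial.C a : ℤ[T;T⁻¹]) • m = a • m := by
  rw [alexander_smul_def]
  simp

/-- The restriction of an endomorphism of `G` to `G'`. -/
def commutatorMap (σ : G →* G) : commutator G →* commutator G :=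
  (σ.comp (commutator G).subtype).codRestrict (commutator G) fun h =>
    (Subgroup.map_le_iff_le_comap.1 (by
      rw [commutator_def, Subgroup.map_commutator]
      exact Subgroup.commutator_mono le_top le_top) : commutator G ≤ (commutator G).comap σ) h.2

theorem commutatorMap_surjective {σ : G →* G} (hσ : Function.Surjective σ) :
    Function.Surjective (commutatorMap σ) := by
  rintro ⟨g, hg⟩
  have : (commutator G).map σ = commutator G := by
    rw [commutator_def, Subgroup.map_commutator, Subgroup.map_top_of_surjective σ hσ]
  rw [← this] at hg
  obtain ⟨h, hh, rfl⟩ := hg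
  exact ⟨⟨h, hh⟩, rfl⟩

/-- The additive endomorphism of `G' / G''` induced by an endomorphism of `G`. -/
def alexanderMap (μ : G) (σ : G →* G) : AlexanderModule μ →+ AlexanderModule μ :=
  MonoidHom.toAdditive (Abelianization.map (commutatorMap σ))

theorem alexanderMap_class (μ : G) (σ : G →* G) (h : commutator G) :
    alexanderMap μ σ (alexanderClass μ h).toAdd =
      (alexanderClass μ (commutatorMap σ h)).toAdd := rfl

theorem alexanderMap_surjective (μ : G) {σ : G →* G} (hσ : Function.Surjective σ) :
    Function.Surjective (alexanderMap μ σ) := by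
  intro m
  obtain ⟨h, rfl⟩ := alexanderClass_surjective μ m
  obtain ⟨k, rfl⟩ := commutatorMap_surjective hσ h
  exact ⟨_, alexanderMap_class μ σ k⟩

theorem alexanderMap_conjHom (μ : G) (σ : G →* G) (g : G) (m : AlexanderModule μ) :
    alexanderMap μ σ (conjHom μ g m) = conjHom μ (σ g) (alexanderMap μ σ m) := by
  obtain ⟨h, rfl⟩ := alexanderClass_surjective μ m
  rw [conjHom_class, alexanderMap_class, alexanderMap_class, conjHom_class]
  congr 2
  ext
  change σ (g * h * g⁻¹) = σ g * σ h * (σ g)⁻¹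
  simp

/-- An endomorphism turns conjugation by `g` into conjugation by `σ g`, and `σ μ` acts as `μ⁻¹`;
hence the semilinearity for `t ↦ t⁻¹`. -/
theorem alexanderMap_smul {μ : G} {σ : G →* G}
    (hσμ : Abelianization.of (σ μ) = (Abelianization.of μ)⁻¹)
    (p : ℤ[T;T⁻¹]) (m : AlexanderModule μ) :
    alexanderMap μ σ (p • m) = LaurentPolynomial.invert p • alexanderMap μ σ m := by
  induction p using LaurentPolynomial.induction_on' generalizing m with
  | add p q hp hq => rw [add_smul, map_add, hp, hq, map_add, add_smul]
  | C_mul_T n a =>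
    rw [map_mul, LaurentPolynomial.invert_C, LaurentPolynomial.invert_T, mul_smul, mul_smul,
      C_smul, C_smul, map_zsmul, T_smul, T_smul, alexanderMap_conjHom]
    congr 2
    apply conjHom_eq_of_of_eq
    rw [map_zpow, map_zpow, map_inv, map_zpow, map_inv, hσμ]
    simp

/-- A semilinear surjection carries generators to generators and a relation matrix to its image
under `t ↦ t⁻¹`, and the determinant commutes with ring homomorphisms. -/
theorem invert_mem_orderIdeal {μ : G} {σ : G →* G} (hσ : Function.Surjective σ)
    (hσμ : Abelianization.of (σ μ) = (Abelianization.of μ)⁻¹)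
    {d : ℤ[T;T⁻¹]} (hd : d ∈ orderIdeal ℤ[T;T⁻¹] (AlexanderModule μ)) :
    LaurentPolynomial.invert d ∈ orderIdeal ℤ[T;T⁻¹] (AlexanderModule μ) := by
  suffices h : orderIdeal ℤ[T;T⁻¹] (AlexanderModule μ) ≤
      (orderIdeal ℤ[T;T⁻¹] (AlexanderModule μ)).comap
        (LaurentPolynomial.invert (R := ℤ)).toRingEquiv.toRingHom from h hd
  refine Ideal.span_le.2 ?_
  rintro _ ⟨n, g, A, hg, hA, rfl⟩
  refine Ideal.subset_span ⟨n, fun i => alexanderMap μ σ (g i),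
    A.map (LaurentPolynomial.invert (R := ℤ)), ?_, ?_, ?_⟩
  · rw [eq_top_iff]
    -- The preimage of the span under the semilinear map is a submodule, and it contains the
    -- generators `g i`.
    let N : Submodule ℤ[T;T⁻¹] (AlexanderModule μ) :=
      { carrier := {m | alexanderMap μ σ m ∈
          Submodule.span ℤ[T;T⁻¹] (Set.range fun i => alexanderMap μ σ (g i))}
        add_mem' := fun {a b} ha hb => by
          rw [Set.mem_ofPred_eq, map_add]
          exact add_mem ha hb
        zero_mem' := by
          rw [Set.mem_ofPred_eq, map_zero]
          exact zero_mem _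
        smul_mem' := fun c x hx => by
          rw [Set.mem_ofPred_eq, alexanderMap_smul hσμ]
          exact Submodule.smul_mem _ _ hx }
    have hN : N = ⊤ := by
      rw [eq_top_iff, ← hg, Submodule.span_le]
      rintro _ ⟨i, rfl⟩
      exact Submodule.subset_span ⟨i, rfl⟩
    intro m _
    obtain ⟨m', rfl⟩ := alexanderMap_surjective μ hσ m
    exact (hN ▸ Submodule.mem_top : m' ∈ N)
  · intro i
    rw [← map_zero (alexanderMap μ σ), ← hA i, map_sum]
    exact Finset.sum_congr rfl fun j _ => (alexanderMap_smul hσμ _ _).symm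
  · exact RingHom.map_det (LaurentPolynomial.invert (R := ℤ)).toRingEquiv.toRingHom A

theorem T_sub_one_mem_span (n : ℤ) :
    (LaurentPolynomial.T n - 1 : ℤ[T;T⁻¹]) ∈ Ideal.span {(LaurentPolynomial.T 1 - 1 : ℤ[T;T⁻¹])} := by
  rw [Ideal.mem_span_singleton]
  have hnat : ∀ k : ℕ, (LaurentPolynomial.T 1 - 1 : ℤ[T;T⁻¹]) ∣ LaurentPolynomial.T k - 1 := by
    intro k
    have := sub_dvd_pow_sub_pow (LaurentPolynomial.T 1 : ℤ[T;T⁻¹]) 1 k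
    simpa [LaurentPolynomial.T_pow] using this
  obtain ⟨k, rfl | rfl⟩ := n.eq_nat_or_neg
  · exact hnat k
  · obtain ⟨c, hc⟩ := hnat k
    refine ⟨-(LaurentPolynomial.T (-k) * c), ?_⟩
    have h1 : (LaurentPolynomial.T (-k) * LaurentPolynomial.T k : ℤ[T;T⁻¹]) = 1 := by
      rw [← LaurentPolynomial.T_add]; simp
    linear_combination (-LaurentPolynomial.T (-k) : ℤ[T;T⁻¹]) * hc + h1

/-- If `μ` generates the abelianization, then `t - 1` is surjective on `G' / G''`. -/
theorem alexander_le_smul {μ : G}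
    (hgen : ∀ g : G, ∃ n : ℤ, Abelianization.of g = Abelianization.of μ ^ n) :
    (⊤ : Submodule ℤ[T;T⁻¹] (AlexanderModule μ)) ≤
      Ideal.span {(LaurentPolynomial.T 1 - 1 : ℤ[T;T⁻¹])} • ⊤ := by
  set N : Submodule ℤ[T;T⁻¹] (AlexanderModule μ) :=
    Ideal.span {(LaurentPolynomial.T 1 - 1 : ℤ[T;T⁻¹])} • ⊤ with hN
  have hconj : ∀ (g : G) (m : AlexanderModule μ), conjHom μ g m - m ∈ N := by
    intro g m
    obtain ⟨n, hn⟩ := hgen g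
    have h1 : conjHom μ g m = (LaurentPolynomial.T (-n) : ℤ[T;T⁻¹]) • m := by
      rw [T_smul, conjHom_eq_of_of_eq μ (g' := μ⁻¹ ^ (-n))]
      rw [hn]; simp
    have h2 : conjHom μ g m - m = (LaurentPolynomial.T (-n) - 1 : ℤ[T;T⁻¹]) • m := by
      rw [h1, sub_smul, one_smul]
    rw [h2]
    exact Submodule.smul_mem_smul (T_sub_one_mem_span _) Submodule.mem_top
  -- `K` is the preimage of `(t - 1) M` in `G'`, regarded as a subgroup of `G`; the aim is `G' ≤ K`.
  let K : Subgroup G :=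
    { carrier := {x | ∃ hx : x ∈ commutator G, (alexanderClass μ ⟨x, hx⟩).toAdd ∈ N}
      mul_mem' := by
        rintro a b ⟨ha, ha'⟩ ⟨hb, hb'⟩
        exact ⟨mul_mem ha hb, add_mem ha' hb'⟩
      one_mem' := ⟨one_mem _, zero_mem N⟩
      inv_mem' := by
        rintro a ⟨ha, ha'⟩
        exact ⟨inv_mem ha, neg_mem (S := Submodule ℤ[T;T⁻¹] (AlexanderModule μ)) ha'⟩ }
  have hcomm : ∀ (g : G), ∀ h ∈ commutator G, g * h * g⁻¹ * h⁻¹ ∈ K := by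
    intro g h hh
    have h1 : g * h * g⁻¹ ∈ commutator G := (inferInstance : (commutator G).Normal).conj_mem h hh g
    refine ⟨mul_mem h1 (inv_mem hh), ?_⟩
    have := hconj g (alexanderClass μ ⟨h, hh⟩).toAdd
    rw [conjHom_class, sub_eq_add_neg] at this
    exact this
  have : K.Normal := by
    refine ⟨fun k hk g => ?_⟩
    have := mul_mem (hcomm g k hk.1) hk
    simpa using this
  -- `G' / K` is central in `G / K` by `hcomm`, and `G` is generated by `μ` and `G'`. So `G / K` is
  -- generated by one element and a central subgroup, hence commutative.
  have hle : commutator G ≤ K := by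
    rw [commutator_def, Subgroup.commutator_le]
    intro a _ b _
    have hcent : ∀ h ∈ commutator G, ∀ g : G, Commute (g : G ⧸ K) (h : G ⧸ K) := by
      intro h hh g
      have := (QuotientGroup.eq_one_iff _).2 (hcomm g h hh)
      simp only [QuotientGroup.mk_mul, QuotientGroup.mk_inv] at this
      rwa [mul_inv_eq_one, mul_inv_eq_iff_eq_mul] at this
    have hdec : ∀ g : G, ∃ (n : ℤ) (h : G), h ∈ commutator G ∧ g = μ ^ n * h := by
      intro g
      obtain ⟨n, hn⟩ := hgen g
      refine ⟨n, (μ ^ n)⁻¹ * g, ?_, by group⟩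
      rw [← Abelianization.ker_of G, MonoidHom.mem_ker, map_mul, hn]
      simp
    obtain ⟨i, h, hh, rfl⟩ := hdec a
    obtain ⟨j, k, hk, rfl⟩ := hdec b
    rw [← QuotientGroup.eq_one_iff, ← QuotientGroup.mk'_apply, map_commutatorElement,
      commutatorElement_eq_one_iff_commute]
    simp only [QuotientGroup.mk'_apply, QuotientGroup.mk_mul, QuotientGroup.mk_zpow]
    refine Commute.mul_left (Commute.mul_right ?_ (hcent k hk _)) ?_
    · exact (Commute.refl _).zpow_zpow _ _
    · exact ((hcent h hh (μ ^ j * k)).symm)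
  intro m _
  obtain ⟨h, rfl⟩ := alexanderClass_surjective μ m
  exact (hle h.2).2

/-- If the Alexander module is finitely generated and `μ` generates the abelianization, the order
ideal contains an element with value `1` at `t = 1`. -/
theorem exists_mem_orderIdeal_evalOne {μ : G}
    (hgen : ∀ g : G, ∃ n : ℤ, Abelianization.of g = Abelianization.of μ ^ n)
    {n : ℕ} {g : Fin n → AlexanderModule μ} (hg : Submodule.span ℤ[T;T⁻¹] (Set.range g) = ⊤) :
    ∃ e ∈ orderIdeal ℤ[T;T⁻¹] (AlexanderModule μ), evalOne e = 1 := by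
  -- Nakayama: some `r ≡ 1` modulo `t - 1` annihilates the module. The scalar matrix `r` then
  -- consists of relations, with determinant `r ^ n`.
  obtain ⟨r, hr, hr0⟩ := Submodule.exists_sub_one_mem_and_smul_eq_zero_of_fg_of_le_smul
    _ ⊤ (hg ▸ Submodule.fg_span (Set.finite_range g)) (alexander_le_smul hgen)
  refine ⟨r ^ n, Ideal.subset_span ⟨n, g, Matrix.diagonal fun _ => r, hg, fun i => ?_, ?_⟩, ?_⟩
  · simp [Matrix.diagonal_apply, hr0]
  · simp
  · obtain ⟨c, hc⟩ := Ideal.mem_span_singleton.1 hr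
    have : evalOne r = 1 := by
      have := congrArg evalOne hc
      simpa [evalOne_T, sub_eq_zero] using this
    rw [map_pow, this, one_pow]

/-- The algebraic part: the presence of an endomorphism of `G` onto `G` which inverts a generator
of the abelianization forces `τ = 0`. -/
theorem tauInvariant_eq_zero_of_isIdealGCD {μ : G}
    (hgen : ∀ g : G, ∃ n : ℤ, Abelianization.of g = Abelianization.of μ ^ n)
    {σ : G →* G} (hσ : Function.Surjective σ)
    (hσμ : Abelianization.of (σ μ) = (Abelianization.of μ)⁻¹)
    {Δ : ℤ[T;T⁻¹]} (hΔ : IsIdealGCD (orderIdeal ℤ[T;T⁻¹] (AlexanderModule μ)) Δ) :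
    tauInvariant Δ = 0 := by
  by_cases hfg : ∃ (n : ℕ) (g : Fin n → AlexanderModule μ),
      Submodule.span ℤ[T;T⁻¹] (Set.range g) = ⊤
  · obtain ⟨n, g, hg⟩ := hfg
    obtain ⟨e, he, he1⟩ := exists_mem_orderIdeal_evalOne hgen hg
    have hodd : Odd (evalOne Δ) := by
      have h1 := map_dvd evalOne (hΔ.1 e he)
      rw [he1] at h1
      rcases Int.isUnit_iff.1 (isUnit_of_dvd_one h1) with h | h <;> rw [h] <;> decide
    -- As the ideal is stable under `t ↦ t⁻¹`, the image of `Δ` is again a common divisor. Inverting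
    -- this divisibility gives the opposite one, so the two are associated.
    have h1 : LaurentPolynomial.invert Δ ∣ Δ := hΔ.2 _ fun d hd => by
      have := map_dvd (LaurentPolynomial.invert (R := ℤ))
        (hΔ.1 _ (invert_mem_orderIdeal hσ hσμ hd))
      rwa [LaurentPolynomial.involutive_invert d] at this
    have h2 : Δ ∣ LaurentPolynomial.invert Δ := by
      have := map_dvd (LaurentPolynomial.invert (R := ℤ)) h1
      rwa [LaurentPolynomial.involutive_invert Δ] at this
    obtain ⟨u, hu⟩ := associated_of_dvd_dvd h2 h1
    obtain ⟨ε, k, hε, huε⟩ := LaurentPolynomial.exists_eq_of_isUnit u.isUnit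
    exact tauInvariant_eq_zero_of_invert_eq hodd hε (by rw [← hu, huε, mul_comm])
  -- Without finite generation the ideal is spanned by the empty set and `Δ = 0`. Then `τ` is an
  -- empty sum in `ZMod 0`.
  · have h0 : orderIdeal ℤ[T;T⁻¹] (AlexanderModule μ) = ⊥ := by
      rw [orderIdeal, Ideal.span_eq_bot]
      rintro _ ⟨n, g, A, hg, -⟩
      exact absurd ⟨n, g, hg⟩ hfg
    have : Δ = 0 := zero_dvd_iff.1 (hΔ.2 0 fun e he => by
      rw [h0, Ideal.mem_bot] at he; rw [he])
    simp [this, tauInvariant]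

end AlexanderModule

/-! ### Path cocycles -/

open Topology unitInterval in
/-- A cocycle on the fundamental groupoid of `X` with values in an abelian group. -/
structure PathCocycle (X A : Type*) [TopologicalSpace X] [AddCommGroup A] where
  /-- the value on a path -/
  val : ∀ {a b : X}, Path a b → A
  val_trans : ∀ {a b c : X} (p : Path a b) (q : Path b c), val (p.trans q) = val p + val q
  val_homotopic : ∀ {a b : X} {p q : Path a b}, p.Homotopic q → val p = val q

namespace PathCocycle

open Topology unitInterval

variable {X Y A : Type*} [TopologicalSpace X] [TopologicalSpace Y] [AddCommGroup A]

/-- Allows comparison of paths whose end points are equal but not definitionally so, without casts.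
-/
theorem val_congr (c : PathCocycle X A) {a b a' b' : X} (p : Path a b) (q : Path a' b')
    (h : ∀ t, p t = q t) : c.val p = c.val q := by
  obtain rfl : a = a' := by simpa using h 0
  obtain rfl : b = b' := by simpa using h 1
  congr 1
  ext t
  exact h t

theorem val_refl (c : PathCocycle X A) (a : X) : c.val (Path.refl a) = 0 := by
  have h := c.val_trans (Path.refl a) (Path.refl a)
  rw [Path.refl_trans_refl] at h
  simpa using h

theorem val_symm (c : PathCocycle X A) {a b : X} (p : Path a b) : c.val p.symm = -c.val p := by
  have h := c.val_homotopic ⟨Path.Homotopy.reflTransSymm p⟩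
  rw [c.val_trans, c.val_refl] at h
  exact eq_neg_of_add_eq_zero_right h.symm

/-- The pullback of a cocycle along a continuous map. -/
def comap (c : PathCocycle X A) (e : C(Y, X)) : PathCocycle Y A where
  val p := c.val (p.map e.continuous)
  val_trans p q := by rw [Path.map_trans, c.val_trans]
  val_homotopic h := c.val_homotopic (h.map e)

theorem comap_val (c : PathCocycle X A) (e : C(Y, X)) {a b : Y} (p : Path a b) :
    (c.comap e).val p = c.val (p.map e.continuous) := rfl

/-- On a simply connected space, cocycles are coboundaries. -/
theorem exists_potential [SimplyConnectedSpace Y] (c : PathCocycle Y A) :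
    ∃ g : Y → A, ∀ (a b : Y) (p : Path a b), c.val p = g b - g a := by
  obtain ⟨y₀⟩ : Nonempty Y := inferInstance
  refine ⟨fun y => c.val (PathConnectedSpace.somePath y₀ y), fun a b p => ?_⟩
  rw [eq_sub_iff_add_eq', ← c.val_trans]
  exact c.val_homotopic (SimplyConnectedSpace.paths_homotopic _ _)

/-- The pullback of a cocycle along a map from a convex set that is invariant under a translation
takes only one value on the paths that join points to their translates. -/
theorem exists_period {V : Type*} [AddCommGroup V] [Module ℝ V] [TopologicalSpace V]
    [ContinuousAdd V] [ContinuousSMul ℝ V] {E : Set V} (hE : Convex ℝ E) (c : PathCocycle X A)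
    (e : C(E, X)) {τ : V} (hτ : ∀ w ∈ E, w + τ ∈ E)
    (he : ∀ w w' : E, (w' : V) = w + τ → e w' = e w) :
    ∃ k : A, ∀ (w w' : E) (q : Path w w'), (w' : V) = w + τ → c.val (q.map e.continuous) = k := by
  rcases E.eq_empty_or_nonempty with rfl | hne
  · exact ⟨0, fun w => w.2.elim⟩
  have := hE.contractibleSpace hne
  obtain ⟨g, hg⟩ := (c.comap e).exists_potential
  obtain ⟨w₀, hw₀⟩ := hne
  refine ⟨g ⟨w₀ + τ, hτ _ hw₀⟩ - g ⟨w₀, hw₀⟩, fun w w' q hw => ?_⟩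
  rw [← comap_val, hg]
  let r : Path (⟨w₀, hw₀⟩ : E) w := PathConnectedSpace.somePath _ _
  -- A path from `w₀` to `w` and its translate have the same image in `X`, so the increment of the
  -- potential `g` under translation is the same at `w₀` and at `w`.
  have htr : Continuous fun x : E => (⟨x + τ, hτ _ x.2⟩ : E) := by fun_prop
  have h1 : (c.comap e).val (r.map htr) = (c.comap e).val r :=
    c.val_congr _ _ fun t => he _ _ rfl
  rw [hg, hg] at h1
  obtain rfl : w' = ⟨w + τ, hτ _ w.2⟩ := Subtype.ext hw
  rw [sub_eq_sub_iff_add_eq_add] at h1 ⊢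
  rw [h1, add_comm]

/-- If a cocycle is the coboundary of `f` near each point of a path, then it is so on the path. -/
theorem val_eq_of_local (c : PathCocycle X A) (f : X → A) {a b : X} (p : Path a b)
    (h : ∀ t, ∃ W ∈ 𝓝 (p t), ∀ (a' b' : X) (q : Path a' b'), (∀ s, q s ∈ W) →
      c.val q = f b' - f a') : c.val p = f b - f a := by
  -- The defect between the cocycle along the initial piece and the potential is locally constant on
  -- the interval, hence constant.
  let g : I → A := fun t => c.val (p.subpath 0 t) - f (p t)
  have hloc : IsLocallyConstant g := by
    rw [IsLocallyConstant.iff_eventually_eq]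
    intro t
    obtain ⟨W, hW, hf⟩ := h t
    have hev : ∀ᶠ s in 𝓝 t, Set.uIcc t s ⊆ p ⁻¹' W :=
      ((tendsto_const_nhds (x := t)).uIcc Filter.tendsto_id).eventually
        (Filter.eventually_smallSets.2 ⟨_, p.continuous.continuousAt hW, fun _ h => h⟩)
    filter_upwards [hev] with s hs
    have h1 := c.val_homotopic ⟨Path.Homotopy.subpathTransSubpath p 0 t s⟩
    have h2 := hf _ _ (p.subpath t s) fun u => by
      have : p.subpath t s u ∈ Set.range (p.subpath t s) := ⟨u, rfl⟩
      rw [Path.range_subpath] at this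
      obtain ⟨v, hv, hv'⟩ := this
      rw [← hv']
      exact hs hv
    rw [c.val_trans] at h1
    simp only [g]
    rw [← h1, h2]
    abel
  have h01 := hloc.apply_eq_of_preconnectedSpace 1 0
  simp only [g] at h01
  rw [Path.subpath_self, c.val_refl, c.val_congr (p.subpath 0 1) p (fun t => by simp)] at h01
  rw [Path.source, Path.target] at h01
  rw [sub_eq_iff_eq_add] at h01
  rw [h01]; abel

/-- The cocycle is a coboundary on the paths in `S`. -/
def TrivialOn (c : PathCocycle X A) (S : Set X) : Prop :=
  ∃ f : X → A, ∀ (a b : X) (p : Path a b), (∀ t, p t ∈ S) → c.val p = f b - f a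

theorem TrivialOn.mono {c : PathCocycle X A} {S T : Set X} (h : c.TrivialOn T) (hST : S ⊆ T) :
    c.TrivialOn S := by
  obtain ⟨f, hf⟩ := h
  exact ⟨f, fun a b p hp => hf a b p fun t => hST (hp t)⟩

/-- On the path connected overlap the two potentials differ by a constant. After a shift they glue
to a function that is a potential near each point, which is enough by `val_eq_of_local`. -/
theorem TrivialOn.union {c : PathCocycle X A} {U₁ U₂ : Set X} (h₁ : c.TrivialOn U₁)
    (h₂ : c.TrivialOn U₂) (ho₁ : IsOpen U₁) (ho₂ : IsOpen U₂)
    (hj : ∀ a ∈ U₁ ∩ U₂, ∀ b ∈ U₁ ∩ U₂, JoinedIn (U₁ ∩ U₂) a b) : c.TrivialOn (U₁ ∪ U₂) := by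
  classical
  obtain ⟨f₁, hf₁⟩ := h₁
  obtain ⟨f₂, hf₂⟩ := h₂
  obtain ⟨k, hk⟩ : ∃ k, ∀ x ∈ U₁ ∩ U₂, f₁ x = f₂ x + k := by
    rcases (U₁ ∩ U₂).eq_empty_or_nonempty with he | ⟨x₀, hx₀⟩
    · exact ⟨0, fun x hx => by simp [he] at hx⟩
    · refine ⟨f₁ x₀ - f₂ x₀, fun x hx => ?_⟩
      obtain ⟨p, hp⟩ := hj x₀ hx₀ x hx
      have h := (hf₁ _ _ p fun t => (hp t).1).symm.trans (hf₂ _ _ p fun t => (hp t).2)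
      rw [sub_eq_iff_eq_add] at h
      rw [h]; abel
  let f : X → A := fun x => if x ∈ U₁ then f₁ x else f₂ x + k
  have hfU₂ : ∀ x ∈ U₂, f x = f₂ x + k := fun x hx => by
    by_cases hx₁ : x ∈ U₁
    · simp only [f, if_pos hx₁, hk x ⟨hx₁, hx⟩]
    · simp only [f, if_neg hx₁]
  refine ⟨f, fun a b p hp => c.val_eq_of_local f p fun t => ?_⟩
  rcases hp t with ht | ht
  · refine ⟨U₁, ho₁.mem_nhds ht, fun a' b' q hq => ?_⟩
    have ha := hq 0
    have hb := hq 1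
    rw [Path.source] at ha
    rw [Path.target] at hb
    simp only [f, if_pos ha, if_pos hb, hf₁ _ _ q hq]
  · refine ⟨U₂, ho₂.mem_nhds ht, fun a' b' q hq => ?_⟩
    have ha := hq 0
    have hb := hq 1
    rw [Path.source] at ha
    rw [Path.target] at hb
    rw [hfU₂ _ ha, hfU₂ _ hb, hf₂ _ _ q hq]
    abel

/-! ### Van Kampen type gluing in the complement of a closed set -/

section Convex

variable {E : Type*} [NormedAddCommGroup E] [NormedSpace ℝ E] {Z : Set E}

/-- The set `K` has an open convex neighbourhood on which the cocycle is trivial. -/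
def TrivialNear (c : PathCocycle {y : E // y ∉ Z} A) (K : Set E) : Prop :=
  ∃ U : Set E, IsOpen U ∧ Convex ℝ U ∧ K ⊆ U ∧ c.TrivialOn (Subtype.val ⁻¹' U)

theorem TrivialNear.mono {c : PathCocycle {y : E // y ∉ Z} A} {K L : Set E}
    (h : c.TrivialNear L) (hKL : K ⊆ L) : c.TrivialNear K := by
  obtain ⟨U, h1, h2, h3, h4⟩ := h
  exact ⟨U, h1, h2, hKL.trans h3, h4⟩

variable (hZ : ∀ W : Set E, IsOpen W → Convex ℝ W → ∀ a b : {y : E // y ∉ Z},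
  a.1 ∈ W → b.1 ∈ W → JoinedIn (Subtype.val ⁻¹' W) a b)

include hZ in
-- A thin thickening of the convex compact set `M` lies in the union of the two given
-- neighbourhoods. Intersecting it with both leaves a convex open set, which `Z` does not
-- disconnect, so the potentials glue.
theorem TrivialNear.union {c : PathCocycle {y : E // y ∉ Z} A} {K L M : Set E}
    (hK : c.TrivialNear K) (hL : c.TrivialNear L) (hM : IsCompact M) (hMc : Convex ℝ M)
    (hMKL : M ⊆ K ∪ L) : c.TrivialNear M := by
  obtain ⟨U, hUo, hUc, hKU, hUt⟩ := hK
  obtain ⟨V, hVo, hVc, hLV, hVt⟩ := hL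
  obtain ⟨δ, hδ, hδ'⟩ := hM.exists_thickening_subset_open (hUo.union hVo)
    (hMKL.trans (Set.union_subset_union hKU hLV))
  have hco : Continuous (Subtype.val : {y : E // y ∉ Z} → E) := continuous_subtype_val
  refine ⟨Metric.thickening δ M, Metric.isOpen_thickening, hMc.thickening δ,
    Metric.self_subset_thickening hδ M, ?_⟩
  refine (TrivialOn.union (U₁ := Subtype.val ⁻¹' (Metric.thickening δ M ∩ U))
    (U₂ := Subtype.val ⁻¹' (Metric.thickening δ M ∩ V))
    (hUt.mono fun x hx => hx.2) (hVt.mono fun x hx => hx.2)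
    ((Metric.isOpen_thickening.inter hUo).preimage hco)
    ((Metric.isOpen_thickening.inter hVo).preimage hco) ?_).mono ?_
  · intro a ha b hb
    rw [← Set.preimage_inter] at *
    exact hZ _ ((Metric.isOpen_thickening.inter hUo).inter (Metric.isOpen_thickening.inter hVo))
      (((hMc.thickening δ).inter hUc).inter ((hMc.thickening δ).inter hVc)) a b ha hb
  · intro x hx
    rcases hδ' hx with h | h
    · exact Or.inl ⟨hx, h⟩
    · exact Or.inr ⟨hx, h⟩

include hZ in
/-- If the cocycle is trivial near every slice of a compact convex set, it is trivial near the
whole set. -/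
theorem TrivialNear.of_slices {c : PathCocycle {y : E // y ∉ Z} A} {K : Set E}
    (hK : IsCompact K) (hKc : Convex ℝ K) (l : E →L[ℝ] ℝ)
    (h : ∀ t : ℝ, c.TrivialNear (K ∩ l ⁻¹' {t})) : c.TrivialNear K := by
  have hloc : ∀ t : ℝ, ∃ S : Set ℝ, IsOpen S ∧ t ∈ S ∧ c.TrivialNear (K ∩ l ⁻¹' S) := by
    intro t
    obtain ⟨U, hUo, hUc, hKU, hUt⟩ := h t
    -- By compactness, a neighbourhood of the slice over `t` contains the part of `K` over a
    -- neighbourhood of `t`.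
    refine ⟨(l '' (K \ U))ᶜ, ?_, ?_, U, hUo, hUc, ?_, hUt⟩
    · exact ((hK.diff hUo).image l.continuous).isClosed.isOpen_compl
    · rintro ⟨x, ⟨hx, hxU⟩, rfl⟩
      exact hxU (hKU ⟨hx, rfl⟩)
    · rintro x ⟨hx, hxS⟩
      by_contra hxU
      exact hxS ⟨x, ⟨hx, hxU⟩, rfl⟩
  choose S hSo hS hSt using hloc
  obtain ⟨M, hM⟩ := (hK.image l.continuous).isBounded.subset_closedBall 0
  rw [Real.closedBall_eq_Icc, zero_sub, zero_add] at hM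
  rcases K.eq_empty_or_nonempty with rfl | ⟨x, hx⟩
  · exact (h 0).mono (Set.empty_subset _)
  have hle : -M ≤ M := by
    have := hM ⟨x, hx, rfl⟩
    exact this.1.trans this.2
  obtain ⟨t, ht0, htm, ⟨m, hm⟩, hc⟩ := exists_monotone_Icc_subset_open_cover_Icc hle
    (c := fun s : ℝ => Subtype.val ⁻¹' S s) (fun s => (hSo s).preimage continuous_subtype_val)
    (fun x _ => Set.mem_iUnion.2 ⟨x, hS _⟩)
  -- The slabs are added one at a time; every intermediate piece is convex and compact.
  have key : ∀ n, c.TrivialNear (K ∩ l ⁻¹' Set.Icc (-M) (t n)) := by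
    intro n
    induction n with
    | zero =>
      refine (h (-M)).mono (Set.inter_subset_inter_right _ (Set.preimage_mono ?_))
      rw [ht0, Set.Icc_self]
    | succ n ih =>
      obtain ⟨s, hs⟩ := hc n
      refine TrivialNear.union hZ ih (hSt s) ?_ ?_ ?_
      · exact hK.inter_right (isClosed_Icc.preimage l.continuous)
      · exact hKc.inter ((convex_Icc _ _).linear_preimage l.toLinearMap)
      · rintro y ⟨hy, hy1, hy2⟩
        rcases le_total (l y) (t n) with hle | hle
        · exact Or.inl ⟨hy, hy1, hle⟩
        · refine Or.inr ⟨hy, ?_⟩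
          have hmem : (⟨l y, hy1, hy2.trans (t (n + 1)).2.2⟩ : Set.Icc (-M) M) ∈
              Set.Icc (t n) (t (n + 1)) := ⟨hle, hy2⟩
          exact hs hmem
  refine (key m).mono fun y hy => ⟨hy, ?_⟩
  rw [Set.mem_preimage, hm m le_rfl]
  exact hM ⟨y, hy, rfl⟩

end Convex

/-- A cocycle on the complement of `Z ⊆ ℝⁿ` that is trivial near every point of `ℝⁿ` vanishes on
all loops, provided that `Z` does not disconnect open convex sets. -/
theorem val_loop_eq_zero {n : ℕ} {Z : Set (EuclideanSpace ℝ (Fin n))}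
    (hZ : ∀ W : Set (EuclideanSpace ℝ (Fin n)), IsOpen W → Convex ℝ W →
      ∀ a b : {y : EuclideanSpace ℝ (Fin n) // y ∉ Z},
        a.1 ∈ W → b.1 ∈ W → JoinedIn (Subtype.val ⁻¹' W) a b)
    (c : PathCocycle {y : EuclideanSpace ℝ (Fin n) // y ∉ Z} A)
    (hc : ∀ y, c.TrivialNear {y}) {a : {y : EuclideanSpace ℝ (Fin n) // y ∉ Z}} (p : Path a a) :
    c.val p = 0 := by
  -- Induction on the set `s` of free coordinates: no free coordinate leaves at most a point, one
  -- more is gained by sweeping in its direction, and all of them give the whole ball.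
  have key : ∀ (R : ℝ) (s : Finset (Fin n)) (y : EuclideanSpace ℝ (Fin n)),
      c.TrivialNear (Metric.closedBall 0 R ∩ {x | ∀ i ∉ s, x i = y i}) := by
    intro R s
    induction s using Finset.induction_on with
    | empty =>
      intro y
      refine (hc y).mono ?_
      rintro x ⟨-, hx⟩
      ext i
      exact hx i (Finset.notMem_empty i)
    | insert j s hj ih =>
      intro y
      refine TrivialNear.of_slices hZ ?_ ?_ (EuclideanSpace.proj (𝕜 := ℝ) j) fun t => ?_
      · refine (isCompact_closedBall _ _).inter_right ?_
        simp only [Set.ofPred_forall]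
        refine isClosed_iInter fun i => isClosed_iInter fun _ => ?_
        exact isClosed_eq (EuclideanSpace.proj (𝕜 := ℝ) i).continuous continuous_const
      · refine (convex_closedBall _ _).inter ?_
        intro x hx z hz a b _ _ hab i hi
        simp only [PiLp.add_apply, PiLp.smul_apply, smul_eq_mul, hx i hi, hz i hi]
        rw [← add_mul, hab, one_mul]
      · refine (ih (WithLp.toLp 2 (Function.update y.ofLp j t))).mono ?_
        rintro x ⟨⟨hx, hx'⟩, hxt⟩
        refine ⟨hx, fun i hi => ?_⟩
        by_cases hij : i = j
        · subst hij
          simpa using hxt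
        · simpa [Function.update_of_ne hij] using hx' i (by simp [hij, hi])
  have hcomp : IsCompact (Set.range fun t => (p t).1) :=
    isCompact_range (continuous_subtype_val.comp p.continuous)
  obtain ⟨R, hR⟩ := hcomp.isBounded.subset_closedBall 0
  obtain ⟨U, -, -, hU, f, hf⟩ := key R Finset.univ 0
  rw [hf _ _ p fun t => hU ⟨hR ⟨t, rfl⟩, by simp⟩, sub_self]

end PathCocycle

/-! ### Tubular charts and the value of a cocycle on meridians -/

open Topology

namespace TwoKnot

/-- A tubular chart at the point with parameter `s`: a local parametrization of `ℝ⁴` by `ℂ × ℂ`, in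
which the knot is `ℂ × 0`, such that meridian disks wind positively around the knot. -/
structure TubeChart (F : TwoKnot) (s : S2) where
  /-- the parametrization -/
  chart : OpenPartialHomeomorph (ℂ × ℂ) R4
  /-- the size of the domain on which the chart is considered -/
  radius : ℝ
  radius_pos : 0 < radius
  ball_subset : Metric.ball 0 radius ⊆ chart.source
  map_zero : chart 0 = F.toFun s
  mem_range_iff : ∀ q ∈ Metric.ball 0 radius, chart q ∈ Set.range F.toFun ↔ q.2 = 0
  linear : ∀ D : F.MeridianDisk, F.toFun D.center ∈ chart '' Metric.ball 0 radius →
    ∃ α β : ℂ, ‖β‖ < ‖α‖ ∧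
      (fun z : ℂ => (chart.symm (D.toFun z)).2 - (α * z + β * (starRingEnd ℂ) z)) =o[𝓝 0]
        fun z => z

namespace TubeChart

variable {F : TwoKnot} {s : S2} (Θ : F.TubeChart s)

/-- The neighbourhood of the knot point that is covered by the chart. -/
def image : Set R4 := Θ.chart '' Metric.ball 0 Θ.radius

theorem isOpen_image : IsOpen Θ.image :=
  Θ.chart.isOpen_image_of_subset_source Metric.isOpen_ball Θ.ball_subset

theorem mem_image : F.toFun s ∈ Θ.image :=
  ⟨0, Metric.mem_ball_self Θ.radius_pos, Θ.map_zero⟩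

theorem image_subset_target : Θ.image ⊆ Θ.chart.target := by
  rintro _ ⟨q, hq, rfl⟩
  exact Θ.chart.map_source (Θ.ball_subset hq)

theorem symm_mem {y : R4} (hy : y ∈ Θ.image) : Θ.chart.symm y ∈ Metric.ball 0 Θ.radius := by
  obtain ⟨q, hq, rfl⟩ := hy
  rwa [Θ.chart.left_inv (Θ.ball_subset hq)]

theorem symm_snd_ne_zero {y : R4} (hy : y ∈ Θ.image) (hyF : y ∉ Set.range F.toFun) :
    (Θ.chart.symm y).2 ≠ 0 := by
  rw [Ne, ← Θ.mem_range_iff _ (Θ.symm_mem hy), Θ.chart.right_inv (Θ.image_subset_target hy)]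
  exact hyF

theorem continuousOn_symm : ContinuousOn Θ.chart.symm Θ.image :=
  Θ.chart.continuousOn_symm.mono Θ.image_subset_target

/-- The domain of the logarithmic coordinates around the knot. -/
def logDomain : Set (ℂ × ℂ) := Metric.ball 0 Θ.radius ×ˢ {w : ℂ | w.re < Real.log Θ.radius}

theorem convex_logDomain : Convex ℝ Θ.logDomain :=
  (convex_ball _ _).prod (convex_halfSpace_re_lt _)

/-- The norm of `ℂ × ℂ` is the maximum norm, so the ball is a product of two disks and the
exponential maps a half plane onto the second disk without its centre. -/
theorem mem_logDomain_iff {x w : ℂ} :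
    (x, w) ∈ Θ.logDomain ↔ (x, Complex.exp w) ∈ Metric.ball (0 : ℂ × ℂ) Θ.radius := by
  simp only [logDomain, Set.mem_prod, mem_ball_zero_iff, Prod.norm_mk, max_lt_iff, Complex.norm_exp, Set.mem_ofPred_eq,
    Real.lt_log_iff_exp_lt Θ.radius_pos]

/-- The covering of the punctured tube by the logarithmic coordinates. -/
def logMap : C(Θ.logDomain, F.Complement) where
  toFun q := ⟨Θ.chart (q.1.1, Complex.exp q.1.2), by
    rw [Θ.mem_range_iff _ (Θ.mem_logDomain_iff.1 q.2)]
    exact Complex.exp_ne_zero _⟩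
  continuous_toFun := by
    refine Continuous.subtype_mk ?_ _
    refine (Θ.chart.continuousOn.mono Θ.ball_subset).comp_continuous (by fun_prop) fun q => ?_
    exact Θ.mem_logDomain_iff.1 q.2

theorem add_mem_logDomain {q : ℂ × ℂ} (hq : q ∈ Θ.logDomain) (n : ℤ) :
    q + n • ((0, 2 * Real.pi * Complex.I) : ℂ × ℂ) ∈ Θ.logDomain := by
  obtain ⟨x, w⟩ := q
  rw [mem_logDomain_iff] at hq
  have : ((x, w) : ℂ × ℂ) + n • ((0, 2 * Real.pi * Complex.I) : ℂ × ℂ) =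
      (x, w + n * (2 * Real.pi * Complex.I)) := by
    ext <;> simp
  rwa [this, mem_logDomain_iff, Complex.exp_periodic.int_mul n w]

variable {A : Type*} [AddCommGroup A] (c : PathCocycle F.Complement A)

/-- The constant `k` is the value of the cocycle on any loop that winds once around the knot inside
the tube. -/
theorem exists_period : ∃ k : A, ∀ (w w' : Θ.logDomain) (q : Path w w'),
    (w' : ℂ × ℂ) = (w : ℂ × ℂ) + (0, 2 * Real.pi * Complex.I) →
      c.val (q.map Θ.logMap.continuous) = k := by
  refine c.exists_period Θ.convex_logDomain Θ.logMap (fun w hw => ?_) fun w w' h => ?_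
  · simpa using Θ.add_mem_logDomain hw 1
  · apply Subtype.ext
    simp only [logMap, ContinuousMap.coe_mk]
    rw [h]
    simp only [Prod.fst_add, Prod.snd_add, add_zero, Complex.exp_periodic w.1.2]

end TubeChart

/-- The half plane of logarithms of the points of the punctured unit disk. -/
def MeridianDisk.logMap {F : TwoKnot} (D : F.MeridianDisk) :
    C({w : ℂ | w.re ≤ 0}, F.Complement) where
  toFun w := ⟨D.toFun (Complex.exp w), D.notMem _
    (by rw [Complex.norm_exp]; exact Real.exp_le_one_iff.2 w.2) (Complex.exp_ne_zero _)⟩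
  continuous_toFun := by
    refine Continuous.subtype_mk (D.contDiff.continuous.comp ?_) _
    fun_prop

/-- The segment of length `2π` in the half plane of logarithms that lies over the circle of radius
`exp l`. -/
def logSegment (l : ℝ) (hl : l ≤ 0) :
    Path (⟨l, by simpa using hl⟩ : {w : ℂ | w.re ≤ 0})
      ⟨l + 2 * Real.pi * Complex.I, by simpa using hl⟩ where
  toFun t := ⟨l + 2 * Real.pi * (t : ℝ) * Complex.I, by simpa using hl⟩
  continuous_toFun := by fun_prop
  source' := by ext; simp
  target' := by ext; simp

/-- Concentric circles lift to paths in a half plane that differ by translation by `2πi`, so their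
values agree. A meridian can thus be shrunk into a tubular chart. -/
theorem MeridianDisk.val_boundary {F : TwoKnot} (D : F.MeridianDisk) {A : Type*} [AddCommGroup A]
    (c : PathCocycle F.Complement A) (l : ℝ) (hl : l ≤ 0) :
    c.val D.boundary = c.val ((logSegment l hl).map D.logMap.continuous) := by
  obtain ⟨k, hk⟩ := c.exists_period (convex_halfSpace_re_le 0) D.logMap
    (τ := 2 * Real.pi * Complex.I) (fun w hw => by simpa using hw) fun w w' h => by
      apply Subtype.ext
      simp only [logMap, ContinuousMap.coe_mk]
      rw [h, Complex.exp_periodic w.1]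
  rw [hk _ _ _ rfl, ← hk _ _ (logSegment 0 le_rfl) (by simp)]
  refine c.val_congr _ _ fun t => Subtype.ext ?_
  change D.toFun (Circle.exp (2 * Real.pi * (t : ℝ)) : ℂ) =
    D.toFun (Complex.exp ((0 : ℝ) + 2 * Real.pi * (t : ℝ) * Complex.I))
  rw [Circle.coe_exp]
  push_cast
  rw [zero_add]

namespace TubeChart

variable {F : TwoKnot} {s : S2} (Θ : F.TubeChart s)
variable {A : Type*} [AddCommGroup A] (c : PathCocycle F.Complement A)

/-- To first order the normal coordinate of the disk is `α z + β z̄` with `‖β‖ < ‖α‖`. On a small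
circle it is therefore closer to `α z` than `α z` is to `0`, and winds once, in the positive
direction. -/
theorem exists_radius (D : F.MeridianDisk) (hD : F.toFun D.center ∈ Θ.image) :
    ∃ (α : ℂ) (r : ℝ), 0 < r ∧ r ≤ 1 ∧ α ≠ 0 ∧ ∀ z : ℂ, ‖z‖ = r → D.toFun z ∈ Θ.image ∧
      ‖(Θ.chart.symm (D.toFun z)).2 - α * z‖ < ‖α * z‖ := by
  obtain ⟨α, β, hαβ, ho⟩ := Θ.linear D hD
  have h1 : ∀ᶠ z in 𝓝 (0 : ℂ), D.toFun z ∈ Θ.image :=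
    D.contDiff.continuous.continuousAt.eventually
      (Θ.isOpen_image.mem_nhds (by rw [D.map_zero]; exact hD))
  have h2 := ho.def (c := (‖α‖ - ‖β‖) / 2) (by linarith)
  obtain ⟨ε, hε, hball⟩ := Metric.eventually_nhds_iff.1 (h1.and h2)
  refine ⟨α, min (ε / 2) 1, by positivity, min_le_right _ _, ?_, fun z hz => ?_⟩
  · exact norm_pos_iff.1 ((norm_nonneg _).trans_lt hαβ)
  have hzε : dist z 0 < ε := by
    rw [dist_zero_right, hz]
    exact (min_le_left _ _).trans_lt (by linarith)
  obtain ⟨h3, h4⟩ := hball hzε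
  refine ⟨h3, ?_⟩
  have hzpos : 0 < ‖z‖ := by rw [hz]; positivity
  calc ‖(Θ.chart.symm (D.toFun z)).2 - α * z‖
      = ‖((Θ.chart.symm (D.toFun z)).2 - (α * z + β * (starRingEnd ℂ) z)) +
          β * (starRingEnd ℂ) z‖ := by congr 1; ring
    _ ≤ (‖α‖ - ‖β‖) / 2 * ‖z‖ + ‖β‖ * ‖z‖ := by
        refine (norm_add_le _ _).trans (add_le_add h4 ?_)
        rw [norm_mul, RCLike.norm_conj]
    _ < ‖α * z‖ := by
        rw [norm_mul, ← add_mul]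
        exact mul_lt_mul_of_pos_right (by linarith) hzpos

theorem _root_.Complex.div_mem_slitPlane_of_norm_sub_lt {u v : ℂ} (h : ‖u - v‖ < ‖v‖) :
    u / v ∈ Complex.slitPlane := by
  have hv : v ≠ 0 := norm_pos_iff.1 ((norm_nonneg _).trans_lt h)
  have h1 : ‖u / v - 1‖ < 1 := by
    rw [div_sub_one hv, norm_div]
    exact (div_lt_one (norm_pos_iff.2 hv)).2 h
  have := Complex.mem_slitPlane_of_norm_lt_one h1
  simpa using this

/-- All meridian disks with centre in a tubular chart have the same value, and if this value is
zero then the cocycle is trivial in the tube. -/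
theorem exists_val_boundary_eq : ∃ k : A,
    (∀ D : F.MeridianDisk, F.toFun D.center ∈ Θ.image → c.val D.boundary = k) ∧
      (k = 0 → c.TrivialOn (Subtype.val ⁻¹' Θ.image)) := by
  obtain ⟨k, hk⟩ := Θ.exists_period c
  refine ⟨k, fun D hD => ?_, fun hk0 => ?_⟩
  · obtain ⟨α, r, hr, hr1, hα, hDr⟩ := Θ.exists_radius D hD
    have hl : Real.log r ≤ 0 := Real.log_nonpos hr.le hr1
    rw [D.val_boundary c (Real.log r) hl]
    let z : unitInterval → ℂ := fun t =>
      Complex.exp (Real.log r + 2 * Real.pi * (t : ℝ) * Complex.I)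
    have hz : Continuous z := by fun_prop
    have hz0 : ∀ t, z t ≠ 0 := fun t => Complex.exp_ne_zero _
    have hzr : ∀ t, ‖z t‖ = r := fun t => by
      simp only [z, Complex.norm_exp]
      simp [Real.exp_log hr]
    have hz1 : z 1 = z 0 := by
      simp only [z]
      rw [Complex.exp_eq_exp_iff_exists_int]
      exact ⟨1, by simp⟩
    let ζ : unitInterval → ℂ × ℂ := fun t => Θ.chart.symm (D.toFun (z t))
    have hζ : Continuous ζ := Θ.continuousOn_symm.comp_continuous
      (D.contDiff.continuous.comp hz) fun t => (hDr _ (hzr t)).1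
    have hslit : ∀ t, (ζ t).2 / (α * z t) ∈ Complex.slitPlane := fun t =>
      Complex.div_mem_slitPlane_of_norm_sub_lt (hDr _ (hzr t)).2
    -- A continuous logarithm of the normal coordinate: an explicit logarithm of `α z`, which gains
    -- `2πi` along the circle, plus the principal logarithm of a quotient that stays in the slit
    -- plane.
    let w : unitInterval → ℂ := fun t => Complex.log (α * r) +
      2 * Real.pi * (t : ℝ) * Complex.I + Complex.log ((ζ t).2 / (α * z t))
    have hw : Continuous w := by
      refine Continuous.add (by fun_prop) (Continuous.clog ?_ hslit)
      exact hζ.snd.div (continuous_const.mul hz) fun t => mul_ne_zero hα (hz0 t)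
    have hexp : ∀ t, Complex.exp (w t) = (ζ t).2 := fun t => by
      simp only [w]
      rw [Complex.exp_add, Complex.exp_add, Complex.exp_log, Complex.exp_log]
      · have : z t = r * Complex.exp (2 * Real.pi * (t : ℝ) * Complex.I) := by
          simp only [z]
          rw [Complex.exp_add, ← Complex.ofReal_exp, Real.exp_log hr]
        rw [mul_assoc α, ← this, mul_div_cancel₀ _ (mul_ne_zero hα (hz0 t))]
      · exact Complex.slitPlane_ne_zero (hslit t)
      · exact mul_ne_zero hα (by exact_mod_cast hr.ne')
    have hmem : ∀ t, ((ζ t).1, w t) ∈ Θ.logDomain := fun t => by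
      rw [mem_logDomain_iff, hexp]
      exact Θ.symm_mem (hDr _ (hzr t)).1
    let q : Path (⟨_, hmem 0⟩ : Θ.logDomain) ⟨_, hmem 1⟩ :=
      { toFun := fun t => ⟨_, hmem t⟩
        continuous_toFun := by fun_prop
        source' := rfl
        target' := rfl }
    rw [← hk _ _ q]
    · refine c.val_congr _ _ fun t => Subtype.ext ?_
      change D.toFun (z t) = Θ.chart ((ζ t).1, Complex.exp (w t))
      rw [hexp]
      exact (Θ.chart.right_inv (Θ.image_subset_target (hDr _ (hzr t)).1)).symm
    · have hζ1 : ζ 1 = ζ 0 := by simp only [ζ, hz1]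
      ext
      · simp [hζ1]
      · simp only [w, hζ1, hz1, Prod.snd_add]
        simp
        ring
  · classical
    rcases Θ.logDomain.eq_empty_or_nonempty with hemp | hne
    · refine ⟨0, fun a b p hp => ?_⟩
      exfalso
      have ha : (a : R4) ∈ Θ.image := by simpa using hp 0
      have : ((Θ.chart.symm a).1, Complex.log (Θ.chart.symm a).2) ∈ Θ.logDomain := by
        rw [mem_logDomain_iff, Complex.exp_log (Θ.symm_snd_ne_zero ha a.2)]
        exact Θ.symm_mem ha
      rw [hemp] at this
      exact this
    have := Θ.convex_logDomain.contractibleSpace hne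
    obtain ⟨g, hg⟩ := (c.comap Θ.logMap).exists_potential
    -- As `k = 0`, the potential in logarithmic coordinates is `2πi`-periodic and descends to the
    -- punctured tube. Periodicity makes the branch cut of the logarithm in `f` harmless.
    let g' : ℂ × ℂ → A := fun q => if h : q ∈ Θ.logDomain then g ⟨q, h⟩ else 0
    have hper : Function.Periodic g' (0, 2 * Real.pi * Complex.I) := by
      intro q
      by_cases hq : q ∈ Θ.logDomain
      · have hq' : q + (0, 2 * Real.pi * Complex.I) ∈ Θ.logDomain := by
          simpa using Θ.add_mem_logDomain hq 1
        simp only [g', dif_pos hq, dif_pos hq']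
        have h1 := hk ⟨q, hq⟩ ⟨_, hq'⟩ (PathConnectedSpace.somePath _ _) rfl
        rw [← PathCocycle.comap_val, hg, hk0, sub_eq_zero] at h1
        exact h1
      · have hq' : q + (0, 2 * Real.pi * Complex.I) ∉ Θ.logDomain := fun h => hq (by
          have := Θ.add_mem_logDomain h (-1)
          rwa [neg_one_zsmul, add_neg_cancel_right] at this)
        simp only [g', dif_neg hq, dif_neg hq']
    have hg' : ∀ x w w', Complex.exp w = Complex.exp w' → g' (x, w) = g' (x, w') := by
      intro x w w' h
      obtain ⟨n, hn⟩ := Complex.exp_eq_exp_iff_exists_int.1 h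
      have := hper.zsmul n (x, w')
      rw [← this]
      congr 1
      ext <;> simp [hn]
    let f : F.Complement → A := fun y =>
      g' ((Θ.chart.symm y).1, Complex.log (Θ.chart.symm y).2)
    refine ⟨f, fun a b p hp => c.val_eq_of_local f p fun t => ?_⟩
    set v := (Θ.chart.symm (p t)).2 with hv
    have hv0 : v ≠ 0 := Θ.symm_snd_ne_zero (hp t) (p t).2
    have hcont : ContinuousOn (fun y : F.Complement => (Θ.chart.symm y).2 / v)
        (Subtype.val ⁻¹' Θ.image) :=
      (continuous_snd.comp_continuousOn (Θ.continuousOn_symm.comp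
        continuous_subtype_val.continuousOn fun y hy => hy)).div_const v
    refine ⟨_, (hcont.isOpen_inter_preimage (Θ.isOpen_image.preimage continuous_subtype_val)
      Complex.isOpen_slitPlane).mem_nhds ⟨hp t, ?_⟩, fun a' b' q hq => ?_⟩
    · rw [Set.mem_preimage, ← hv, div_self hv0]
      exact Complex.one_mem_slitPlane
    · let w : unitInterval → ℂ := fun u =>
        Complex.log v + Complex.log ((Θ.chart.symm (q u)).2 / v)
      have hζ : Continuous fun u => Θ.chart.symm (q u) := Θ.continuousOn_symm.comp_continuous
        (continuous_subtype_val.comp q.continuous) fun u => (hq u).1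
      have hw : Continuous w :=
        continuous_const.add ((hζ.snd.div_const v).clog fun u => (hq u).2)
      have hexp : ∀ u, Complex.exp (w u) = (Θ.chart.symm (q u)).2 := fun u => by
        simp only [w]
        rw [Complex.exp_add, Complex.exp_log hv0,
          Complex.exp_log (Complex.slitPlane_ne_zero (hq u).2), mul_div_cancel₀ _ hv0]
      have hmem : ∀ u, ((Θ.chart.symm (q u)).1, w u) ∈ Θ.logDomain := fun u => by
        rw [mem_logDomain_iff, hexp]
        exact Θ.symm_mem (hq u).1
      let q' : Path (⟨_, hmem 0⟩ : Θ.logDomain) ⟨_, hmem 1⟩ :=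
        { toFun := fun u => ⟨_, hmem u⟩
          continuous_toFun := by fun_prop
          source' := rfl
          target' := rfl }
      have h1 : c.val q = (c.comap Θ.logMap).val q' := by
        refine c.val_congr _ _ fun u => Subtype.ext ?_
        change (q u : R4) = Θ.chart ((Θ.chart.symm (q u)).1, Complex.exp (w u))
        rw [hexp]
        exact (Θ.chart.right_inv (Θ.image_subset_target (hq u).1)).symm
      have hfg : ∀ u, f (q u) = g ⟨_, hmem u⟩ := fun u => by
        have h2 : g' ((Θ.chart.symm (q u)).1, w u) = g ⟨_, hmem u⟩ := dif_pos (hmem u)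
        rw [← h2]
        refine hg' _ _ _ ?_
        rw [hexp, Complex.exp_log (Θ.symm_snd_ne_zero (hq u).1 (q u).2)]
      have h3 := hfg 0
      have h4 := hfg 1
      rw [h1, hg, ← h3, ← h4, Path.source, Path.target]

end TubeChart

end TwoKnot

/-! ### The differential of an immersion -/

/-- In suitable charts an immersion is `x ↦ (x, 0)` followed by a linear isomorphism, and charts
have invertible differentials. -/
theorem Manifold.IsImmersionAtOfComplement.mfderiv_injective {E E'' F M N : Type*}
    [NormedAddCommGroup E] [NormedSpace ℝ E] [NormedAddCommGroup E''] [NormedSpace ℝ E'']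
    [NormedAddCommGroup F] [NormedSpace ℝ F]
    [TopologicalSpace M] [ChartedSpace E M] [TopologicalSpace N] [ChartedSpace E'' N]
    {n : WithTop ℕ∞} (hn : n ≠ 0) {f : M → N} {x : M}
    (h : IsImmersionAtOfComplement F 𝓘(ℝ, E) 𝓘(ℝ, E'') n f x) :
    Function.Injective (mfderiv 𝓘(ℝ, E) 𝓘(ℝ, E'') f x) := by
  have hφ : h.domChart.MDifferentiable 𝓘(ℝ, E) 𝓘(ℝ, E) :=
    ⟨(contMDiffOn_of_mem_maximalAtlas h.domChart_mem_maximalAtlas).mdifferentiableOn hn,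
      (contMDiffOn_symm_of_mem_maximalAtlas h.domChart_mem_maximalAtlas).mdifferentiableOn hn⟩
  have hψ : h.codChart.MDifferentiable 𝓘(ℝ, E'') 𝓘(ℝ, E'') :=
    ⟨(contMDiffOn_of_mem_maximalAtlas h.codChart_mem_maximalAtlas).mdifferentiableOn hn,
      (contMDiffOn_symm_of_mem_maximalAtlas h.codChart_mem_maximalAtlas).mdifferentiableOn hn⟩
  have hf : MDifferentiableAt 𝓘(ℝ, E) 𝓘(ℝ, E'') f x := h.contMDiffAt.mdifferentiableAt hn
  have hψx := hψ.mdifferentiableAt h.mem_codChart_source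
  have hφx := hφ.mdifferentiableAt h.mem_domChart_source
  let j : E →L[ℝ] E'' := h.equiv.toContinuousLinearMap.comp (ContinuousLinearMap.inl ℝ E F)
  have heq : h.codChart ∘ f =ᶠ[𝓝 x] j ∘ h.domChart := by
    filter_upwards [h.domChart.open_source.mem_nhds h.mem_domChart_source] with y hy
    have hy' : h.domChart y ∈ (h.domChart.extend 𝓘(ℝ, E)).target := by
      simpa using h.domChart.map_source hy
    have := h.writtenInCharts hy'
    simpa [h.domChart.left_inv hy, j] using this
  have h1 : mfderiv 𝓘(ℝ, E) 𝓘(ℝ, E'') (h.codChart ∘ f) x =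
      mfderiv 𝓘(ℝ, E) 𝓘(ℝ, E'') (j ∘ h.domChart) x := heq.mfderiv_eq
  rw [mfderiv_comp x hψx hf, mfderiv_comp x j.mdifferentiableAt hφx] at h1
  rw [injective_iff_map_eq_zero]
  intro v hv
  have h2 := DFunLike.congr_fun h1 v
  rw [ContinuousLinearMap.comp_apply, ContinuousLinearMap.comp_apply, hv, map_zero] at h2
  have hj : Function.Injective (mfderiv 𝓘(ℝ, E) 𝓘(ℝ, E'') j (h.domChart x)) := by
    rw [mfderiv_eq_fderiv, ContinuousLinearMap.fderiv]
    exact h.equiv.injective.comp fun a b hab => (Prod.ext_iff.1 hab).1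
  have h3 := hj (h2.symm.trans (map_zero _).symm)
  exact hφ.mfderiv_injective h.mem_domChart_source (h3.trans (map_zero _).symm)

theorem TwoKnot.mfderiv_injective (F : TwoKnot) (s : S2) :
    Function.Injective (mfderiv (𝓡 2) 𝓘(ℝ, R4) F.toFun s) := by
  obtain ⟨E, _, _, h⟩ := F.isSmoothEmbedding.isImmersion
  exact (h s).mfderiv_injective (by simp)

theorem TwoKnot.contMDiff (F : TwoKnot) : ContMDiff (𝓡 2) 𝓘(ℝ, R4) ∞ F.toFun :=
  F.isSmoothEmbedding.contMDiff

/-! ### Determinants -/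

/-- Euclidean 3-space. -/
abbrev R3 : Type := EuclideanSpace ℝ (Fin 3)

/-- The determinant of three vectors of `ℝ³`. -/
def det3 (a b c : R3) : ℝ := Matrix.det (Matrix.of ![a.ofLp, b.ofLp, c.ofLp])

theorem det3_eq (a b c : R3) : det3 a b c =
    a 0 * b 1 * c 2 - a 0 * b 2 * c 1 - a 1 * b 0 * c 2 + a 1 * b 2 * c 0 + a 2 * b 0 * c 1 -
      a 2 * b 1 * c 0 := by
  simp [det3, Matrix.det_fin_three]

theorem det4_eq (a b c d : R4) : det4 a b c d =
    (a 0 * b 1 - a 1 * b 0) * (c 2 * d 3 - c 3 * d 2) -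
    (a 0 * b 2 - a 2 * b 0) * (c 1 * d 3 - c 3 * d 1) +
    (a 0 * b 3 - a 3 * b 0) * (c 1 * d 2 - c 2 * d 1) +
    (a 1 * b 2 - a 2 * b 1) * (c 0 * d 3 - c 3 * d 0) -
    (a 1 * b 3 - a 3 * b 1) * (c 0 * d 2 - c 2 * d 0) +
    (a 2 * b 3 - a 3 * b 2) * (c 0 * d 1 - c 1 * d 0) := by
  simp [det4, Matrix.det_succ_row_zero, Fin.sum_univ_succ, Fin.succAbove, Matrix.submatrix]
  ring

theorem exists_det3_ne_zero {s : R3} (hs : s ≠ 0) : ∃ a b, det3 s a b ≠ 0 := by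
  have h1 : LinearIndependent ℝ ![s] := by
    simpa [LinearIndependent.pair_iff] using hs
  obtain ⟨a, ha⟩ := exists_linearIndependent_cons_of_lt_finrank h1 (by simp)
  obtain ⟨b, hb⟩ := exists_linearIndependent_cons_of_lt_finrank ha (by simp)
  refine ⟨a, b, fun h0 => ?_⟩
  have h2 := hb.map' (WithLp.linearEquiv 2 ℝ (Fin 3 → ℝ)).toLinearMap (LinearEquiv.ker _)
  have h3 : (Matrix.of ![b.ofLp, a.ofLp, s.ofLp]).row =
      (WithLp.linearEquiv 2 ℝ (Fin 3 → ℝ)).toLinearMap ∘ Fin.cons b (Fin.cons a ![s]) := by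
    ext i : 1
    fin_cases i <;> rfl
  rw [← h3, Matrix.linearIndependent_rows_iff_isUnit, Matrix.isUnit_iff_isUnit_det] at h2
  refine h2.ne_zero ?_
  change det3 b a s = 0
  rw [det3_eq] at *
  linear_combination -h0

theorem exists_det4_pos {u v : R4} (huv : LinearIndependent ℝ ![u, v]) :
    ∃ a b, 0 < det4 u v a b := by
  obtain ⟨a, ha⟩ := exists_linearIndependent_cons_of_lt_finrank huv (by simp)
  obtain ⟨b, hb⟩ := exists_linearIndependent_cons_of_lt_finrank ha (by simp)
  have h2 := hb.map' (WithLp.linearEquiv 2 ℝ (Fin 4 → ℝ)).toLinearMap (LinearEquiv.ker _)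
  have h3 : (Matrix.of ![b.ofLp, a.ofLp, u.ofLp, v.ofLp]).row =
      (WithLp.linearEquiv 2 ℝ (Fin 4 → ℝ)).toLinearMap ∘ Fin.cons b (Fin.cons a ![u, v]) := by
    ext i : 1
    fin_cases i <;> rfl
  rw [← h3, Matrix.linearIndependent_rows_iff_isUnit, Matrix.isUnit_iff_isUnit_det] at h2
  have h4 : det4 b a u v ≠ 0 := h2.ne_zero
  rcases lt_or_gt_of_ne h4 with h | h
  · refine ⟨a, b, ?_⟩
    rw [det4_eq] at *
    linarith
  · refine ⟨b, a, ?_⟩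
    rw [det4_eq] at *
    linarith

/-! ### A chart of the sphere by central projection -/

namespace SphereFrame

/-- The point `s + x e₁ + y e₂` of the affine plane through `s` spanned by `e₁`, `e₂`. -/
def point (s e₁ e₂ : R3) (x : ℂ) : R3 := s + (x.re • e₁ + x.im • e₂)

variable {s e₁ e₂ : R3}

theorem det3_point (x : ℂ) : det3 (point s e₁ e₂ x) e₁ e₂ = det3 s e₁ e₂ := by
  simp only [det3_eq, point, PiLp.add_apply, PiLp.smul_apply, smul_eq_mul]
  ring

theorem point_ne_zero (h : det3 s e₁ e₂ ≠ 0) (x : ℂ) : point s e₁ e₂ x ≠ 0 := by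
  intro h0
  rw [← det3_point x, h0] at h
  simp [det3_eq] at h

theorem hasFDerivAt_point (x : ℂ) : HasFDerivAt (point s e₁ e₂)
    (Complex.reCLM.smulRight e₁ + Complex.imCLM.smulRight e₂) x := by
  unfold point
  exact ((Complex.reCLM.smulRight e₁ + Complex.imCLM.smulRight e₂).hasFDerivAt).const_add s

theorem contDiff_point : ContDiff ℝ ∞ (point s e₁ e₂) := by
  unfold point
  exact contDiff_const.add (Complex.reCLM.smulRight e₁ + Complex.imCLM.smulRight e₂).contDiff

/-- The central projection of the plane to the sphere. -/
def chart (h : det3 s e₁ e₂ ≠ 0) : ℂ → S2 :=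
  Set.codRestrict (fun x => ‖point s e₁ e₂ x‖⁻¹ • point s e₁ e₂ x) _ fun x => by
    simp [norm_smul, point_ne_zero h x]

theorem coe_chart (h : det3 s e₁ e₂ ≠ 0) (x : ℂ) :
    (chart h x : R3) = ‖point s e₁ e₂ x‖⁻¹ • point s e₁ e₂ x := rfl

theorem contDiff_coe_chart (h : det3 s e₁ e₂ ≠ 0) :
    ContDiff ℝ ∞ fun x => ‖point s e₁ e₂ x‖⁻¹ • point s e₁ e₂ x :=
  ((contDiff_point.norm ℝ fun x => point_ne_zero h x).inv fun x =>
    norm_ne_zero_iff.2 (point_ne_zero h x)).smul contDiff_point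

theorem fact_finrank_R3 : Fact (Module.finrank ℝ R3 = 2 + 1) := ⟨by simp⟩

theorem contMDiff_coe : ContMDiff (𝓡 2) 𝓘(ℝ, R3) ∞ (Subtype.val : S2 → R3) :=
  have := fact_finrank_R3
  contMDiff_coe_sphere

theorem contMDiff_chart (h : det3 s e₁ e₂ ≠ 0) : ContMDiff 𝓘(ℝ, ℂ) (𝓡 2) ∞ (chart h) :=
  have := fact_finrank_R3
  (contDiff_coe_chart h).contMDiff.codRestrict_sphere _

/-- Differentiating the factor `‖p‖⁻¹` only contributes multiples of `p`, which the determinant with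
first row proportional to `p` does not see. Each of the three rows leaves one factor `‖p‖⁻¹`. -/
theorem sphereDet_chart (h : det3 s e₁ e₂ ≠ 0) (x : ℂ) :
    sphereDet (chart h x) (mfderiv 𝓘(ℝ, ℂ) (𝓡 2) (chart h) x (1 : ℂ))
      (mfderiv 𝓘(ℝ, ℂ) (𝓡 2) (chart h) x Complex.I) =
        ‖point s e₁ e₂ x‖⁻¹ ^ 3 * det3 s e₁ e₂ := by
  have h1 : ∀ v : ℂ, mfderiv (𝓡 2) 𝓘(ℝ, R3) (Subtype.val : S2 → R3) (chart h x)
      (mfderiv 𝓘(ℝ, ℂ) (𝓡 2) (chart h) x v) =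
        fderiv ℝ (fun x => ‖point s e₁ e₂ x‖⁻¹ • point s e₁ e₂ x) x v := by
    intro v
    rw [← mfderiv_eq_fderiv]
    have h2 := mfderiv_comp (I := 𝓘(ℝ, ℂ)) (I' := 𝓡 2) (I'' := 𝓘(ℝ, R3)) x
      (g := (Subtype.val : S2 → R3)) (f := chart h)
      (contMDiff_coe.mdifferentiableAt (by simp))
      ((contMDiff_chart h).mdifferentiableAt (by simp))
    exact (DFunLike.congr_fun h2 v).symm
  have h3 : DifferentiableAt ℝ (fun x => ‖point s e₁ e₂ x‖⁻¹) x :=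
    (((contDiff_point.norm ℝ fun x => point_ne_zero h x).inv fun x =>
      norm_ne_zero_iff.2 (point_ne_zero h x)).differentiable (by simp)) x
  have h4 : HasFDerivAt (fun x => ‖point s e₁ e₂ x‖⁻¹ • point s e₁ e₂ x) _ x := h3.hasFDerivAt.smul (hasFDerivAt_point (s := s) (e₁ := e₁) (e₂ := e₂) x)
  simp only [sphereDet]
  rw [h1, h1, HasFDerivAt.fderiv h4]
  generalize fderiv ℝ (fun x => ‖point s e₁ e₂ x‖⁻¹) x = L
  change det3 (chart h x) _ _ = _
  rw [coe_chart, ← det3_point (s := s) (e₁ := e₁) (e₂ := e₂) x]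
  generalize point s e₁ e₂ x = p
  simp [det3_eq]
  ring

/-- Cramer's rule gives the coordinates of `s'` in the basis `s`, `e₁`, `e₂`; the first one is
positive near `s`, and dividing by it inverts the central projection. -/
theorem exists_chart_eq (s : S2) {e₁ e₂ : R3} (h : det3 s e₁ e₂ ≠ 0) :
    ∃ ξ : S2 → ℂ, ContinuousAt ξ s ∧ ξ s = 0 ∧ ∀ᶠ s' in 𝓝 s, chart h (ξ s') = s' := by
  set d := det3 s e₁ e₂ with hd
  have hc : ∀ (f : S2 → R3) (g : S2 → R3) (k : S2 → R3), Continuous f → Continuous g →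
      Continuous k → Continuous fun s => det3 (f s) (g s) (k s) := by
    intro f g k hf hg hk
    simp only [det3_eq]
    fun_prop
  let l : S2 → ℝ := fun s' => det3 s' e₁ e₂ / d
  have hl : Continuous l :=
    (hc _ _ _ continuous_subtype_val continuous_const continuous_const).div_const d
  have hls : l s = 1 := div_self h
  let ξ : S2 → ℂ := fun s' => ⟨det3 s s' e₂ / d / l s', det3 s e₁ s' / d / l s'⟩
  have hl0 : ∀ᶠ s' in 𝓝 s, 0 < l s' :=
    hl.continuousAt.eventually (lt_mem_nhds (by rw [hls]; exact one_pos))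
  refine ⟨ξ, ?_, ?_, ?_⟩
  · have h1 : ContinuousAt (fun s' : S2 => det3 s s' e₂ / d / l s') s :=
      ((hc _ _ _ continuous_const continuous_subtype_val
        continuous_const).div_const d).continuousAt.div hl.continuousAt (by rw [hls]; simp)
    have h2 : ContinuousAt (fun s' : S2 => det3 s e₁ s' / d / l s') s :=
      ((hc _ _ _ continuous_const continuous_const
        continuous_subtype_val).div_const d).continuousAt.div hl.continuousAt (by rw [hls]; simp)
    exact Complex.equivRealProdCLM.symm.continuous.continuousAt.comp (h1.prodMk h2)
  · have h1 : det3 s s e₂ = 0 := by rw [det3_eq]; ring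
    have h2 : det3 s e₁ s = 0 := by rw [det3_eq]; ring
    simp only [ξ, h1, h2]
    simp [Complex.ext_iff]
  · filter_upwards [hl0] with s' hs'
    have hp : l s' • point s e₁ e₂ (ξ s') = s' := by
      have hdl : det3 s' e₁ e₂ = l s' * d := (div_mul_cancel₀ _ h).symm
      have hne := hs'.ne'
      ext i
      simp only [point, ξ, PiLp.smul_apply, PiLp.add_apply, smul_eq_mul]
      field_simp
      rw [mul_right_comm, ← hdl, hd]
      simp only [det3_eq]
      fin_cases i <;> simp <;> ring
    have hn : l s' * ‖point s e₁ e₂ (ξ s')‖ = 1 := by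
      have := congrArg norm hp
      rwa [norm_smul, Real.norm_of_nonneg hs'.le, norm_eq_of_mem_sphere] at this
    apply Subtype.ext
    rw [coe_chart, ← eq_inv_of_mul_eq_one_left hn, hp]

end SphereFrame

/-! ### Linear algebra of oriented frames, and the tubular parametrization of the knot. -/

namespace TwoKnot

theorem sphereDet_eq (s : S2) (u v : TangentSpace (𝓡 2) s) : sphereDet s u v =
    det3 s (mfderiv (𝓡 2) 𝓘(ℝ, R3) (Subtype.val : S2 → R3) s u)
      (mfderiv (𝓡 2) 𝓘(ℝ, R3) (Subtype.val : S2 → R3) s v) := rfl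

theorem det3_comb (p a b : R3) (x y x' y' : ℝ) :
    det3 p (x • a + y • b) (x' • a + y' • b) = (x * y' - y * x') * det3 p a b := by
  simp only [det3_eq, PiLp.add_apply, PiLp.smul_apply, smul_eq_mul]
  ring

theorem sphereDet_comb (s : S2) (u v : TangentSpace (𝓡 2) s) (x y x' y' : ℝ) :
    sphereDet s (x • u + y • v) (x' • u + y' • v) = (x * y' - y * x') * sphereDet s u v := by
  simp only [sphereDet_eq, map_add, map_smul]
  exact det3_comb _ _ _ _ _ _ _

theorem det4_comb_left (a b c d : R4) (x y x' y' : ℝ) :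
    det4 (x • a + y • b) (x' • a + y' • b) c d = (x * y' - y * x') * det4 a b c d := by
  simp only [det4_eq, PiLp.add_apply, PiLp.smul_apply, smul_eq_mul]
  ring

theorem det4_comb_right (a b c d : R4) (x y x' y' z w z' w' : ℝ) :
    det4 a b (z • a + w • b + (x • c + y • d)) (z' • a + w' • b + (x' • c + y' • d)) =
      (x * y' - y * x') * det4 a b c d := by
  simp only [det4_eq, PiLp.add_apply, PiLp.smul_apply, smul_eq_mul]
  ring

theorem eq_zero_of_det4_ne_zero {a b c d : R4} (h : det4 a b c d ≠ 0) {x y z w : ℝ}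
    (h0 : x • a + y • b + (z • c + w • d) = 0) : x = 0 ∧ y = 0 ∧ z = 0 ∧ w = 0 := by
  have hi : ∀ i, x * a i + y * b i + (z * c i + w * d i) = 0 := fun i => by
    simpa using congrArg (fun v : R4 => v i) h0
  have h00 := hi 0
  have h01 := hi 1
  have h02 := hi 2
  have h03 := hi 3
  have key : ∀ t : ℝ, t * det4 a b c d = 0 → t = 0 := fun t ht =>
    (mul_eq_zero.1 ht).resolve_right h
  have e1 : det4 (x • a + y • b + (z • c + w • d)) b c d = x * det4 a b c d := by
    simp only [det4_eq, PiLp.add_apply, PiLp.smul_apply, smul_eq_mul]; ring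
  have e2 : det4 a (x • a + y • b + (z • c + w • d)) c d = y * det4 a b c d := by
    simp only [det4_eq, PiLp.add_apply, PiLp.smul_apply, smul_eq_mul]; ring
  have e3 : det4 a b (x • a + y • b + (z • c + w • d)) d = z * det4 a b c d := by
    simp only [det4_eq, PiLp.add_apply, PiLp.smul_apply, smul_eq_mul]; ring
  have e4 : det4 a b c (x • a + y • b + (z • c + w • d)) = w * det4 a b c d := by
    simp only [det4_eq, PiLp.add_apply, PiLp.smul_apply, smul_eq_mul]; ring
  rw [h0] at e1 e2 e3 e4
  refine ⟨key _ ?_, key _ ?_, key _ ?_, key _ ?_⟩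
  · rw [← e1]; simp [det4_eq]
  · rw [← e2]; simp [det4_eq]
  · rw [← e3]; simp [det4_eq]
  · rw [← e4]; simp [det4_eq]

variable (F : TwoKnot) {s e₁ e₂ : R3} (h : det3 s e₁ e₂ ≠ 0)

/-- The knot in a central projection chart of the sphere. -/
def localMap (x : ℂ) : R4 := F.toFun (SphereFrame.chart h x)

theorem contDiff_localMap : ContDiff ℝ ∞ (F.localMap h) :=
  (F.contMDiff.comp (SphereFrame.contMDiff_chart h)).contDiff

theorem fderiv_localMap (x v : ℂ) : fderiv ℝ (F.localMap h) x v =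
    mfderiv (𝓡 2) 𝓘(ℝ, R4) F.toFun (SphereFrame.chart h x)
      (mfderiv 𝓘(ℝ, ℂ) (𝓡 2) (SphereFrame.chart h) x v) := by
  rw [← mfderiv_eq_fderiv]
  have h2 := mfderiv_comp (I := 𝓘(ℝ, ℂ)) (I' := 𝓡 2) (I'' := 𝓘(ℝ, R4)) x
    (g := F.toFun) (f := SphereFrame.chart h)
    (F.contMDiff.mdifferentiableAt (by simp))
    ((SphereFrame.contMDiff_chart h).mdifferentiableAt (by simp))
  exact DFunLike.congr_fun h2 v

theorem _root_.ContinuousLinearMap.apply_complex {E : Type*} [AddCommGroup E] [Module ℝ E]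
    [TopologicalSpace E] (L : ℂ →L[ℝ] E) (z : ℂ) : L z = z.re • L 1 + z.im • L Complex.I := by
  rw [← map_smul, ← map_smul, ← map_add]
  congr 1
  apply Complex.ext <;> simp

theorem _root_.SphereFrame.sphereDet_chart_ne_zero (x : ℂ) :
    sphereDet (SphereFrame.chart h x)
      (mfderiv 𝓘(ℝ, ℂ) (𝓡 2) (SphereFrame.chart h) x (1 : ℂ))
      (mfderiv 𝓘(ℝ, ℂ) (𝓡 2) (SphereFrame.chart h) x Complex.I) ≠ 0 := by
  rw [SphereFrame.sphereDet_chart]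
  exact mul_ne_zero (pow_ne_zero _ (inv_ne_zero (norm_ne_zero_iff.2
    (SphereFrame.point_ne_zero h x)))) h

theorem _root_.SphereFrame.mfderiv_chart_bijective (x : ℂ) :
    Function.Bijective (mfderiv 𝓘(ℝ, ℂ) (𝓡 2) (SphereFrame.chart h) x) := by
  have hinj : Function.Injective (mfderiv 𝓘(ℝ, ℂ) (𝓡 2) (SphereFrame.chart h) x) := by
    rw [injective_iff_map_eq_zero]
    intro (z : ℂ) hz
    have hd := SphereFrame.sphereDet_chart_ne_zero h x
    have hz' := ContinuousLinearMap.apply_complex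
      (mfderiv 𝓘(ℝ, ℂ) (𝓡 2) (SphereFrame.chart h) x : ℂ →L[ℝ] TangentSpace (𝓡 2) _) z
    have hz2 := hz'.symm.trans hz
    have h1 := sphereDet_comb (SphereFrame.chart h x)
      (mfderiv 𝓘(ℝ, ℂ) (𝓡 2) (SphereFrame.chart h) x (1 : ℂ))
      (mfderiv 𝓘(ℝ, ℂ) (𝓡 2) (SphereFrame.chart h) x Complex.I) z.re z.im 0 1
    have h2 := sphereDet_comb (SphereFrame.chart h x)
      (mfderiv 𝓘(ℝ, ℂ) (𝓡 2) (SphereFrame.chart h) x (1 : ℂ))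
      (mfderiv 𝓘(ℝ, ℂ) (𝓡 2) (SphereFrame.chart h) x Complex.I) 1 0 z.re z.im
    have h0 : ∀ w, sphereDet (SphereFrame.chart h x) 0 w = 0 := fun w => by
      simpa using sphereDet_comb _ w w 0 0 1 0
    have h0' : ∀ w, sphereDet (SphereFrame.chart h x) w 0 = 0 := fun w => by
      simpa using sphereDet_comb _ w w 1 0 0 0
    erw [hz2, h0] at h1
    erw [hz2, h0'] at h2
    apply Complex.ext
    · exact (by simpa [hd] using h1.symm : z.re = 0)
    · exact (by simpa [hd] using h2.symm : z.im = 0)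
  refine ⟨hinj, ?_⟩
  have hfr : Module.finrank ℝ ℂ = Module.finrank ℝ (EuclideanSpace ℝ (Fin 2)) := by
    simp
  exact (LinearMap.injective_iff_surjective_of_finrank_eq_finrank
    (f := (mfderiv 𝓘(ℝ, ℂ) (𝓡 2) (SphereFrame.chart h) x :
      ℂ →L[ℝ] EuclideanSpace ℝ (Fin 2)).toLinearMap) hfr).1 hinj

theorem linearIndependent_fderiv_localMap (x : ℂ) :
    LinearIndependent ℝ ![fderiv ℝ (F.localMap h) x 1, fderiv ℝ (F.localMap h) x Complex.I] := by
  rw [LinearIndependent.pair_iff]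
  intro p q hpq
  have h1 := ContinuousLinearMap.apply_complex (fderiv ℝ (F.localMap h) x) ⟨p, q⟩
  rw [hpq, fderiv_localMap] at h1
  have h2 := F.mfderiv_injective _ (h1.trans (map_zero _).symm)
  have h3 := (SphereFrame.mfderiv_chart_bijective h x).1 (h2.trans (map_zero _).symm)
  exact ⟨congrArg Complex.re h3, congrArg Complex.im h3⟩

/-- The tubular parametrization with normal directions `a`, `b`. -/
def tubeMap (a b : R4) (q : ℂ × ℂ) : R4 := F.localMap h q.1 + (q.2.re • a + q.2.im • b)

/-- The differential of the tubular parametrization. -/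
def tubeDeriv (a b : R4) (x : ℂ) : ℂ × ℂ →L[ℝ] R4 :=
  (fderiv ℝ (F.localMap h) x).comp (ContinuousLinearMap.fst ℝ ℂ ℂ) +
    (Complex.reCLM.smulRight a + Complex.imCLM.smulRight b).comp (ContinuousLinearMap.snd ℝ ℂ ℂ)

variable (a b : R4)

theorem tubeDeriv_apply (x : ℂ) (q : ℂ × ℂ) : F.tubeDeriv h a b x q =
    q.1.re • fderiv ℝ (F.localMap h) x 1 + q.1.im • fderiv ℝ (F.localMap h) x Complex.I +
      (q.2.re • a + q.2.im • b) := by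
  rw [← ContinuousLinearMap.apply_complex]
  rfl

theorem contDiff_tubeMap : ContDiff ℝ ∞ (F.tubeMap h a b) :=
  ((F.contDiff_localMap h).comp contDiff_fst).add
    (((Complex.reCLM.smulRight a + Complex.imCLM.smulRight b).contDiff).comp contDiff_snd)

theorem hasFDerivAt_tubeMap (q : ℂ × ℂ) :
    HasFDerivAt (F.tubeMap h a b) (F.tubeDeriv h a b q.1) q := by
  have h1 : HasFDerivAt (F.localMap h) (fderiv ℝ (F.localMap h) q.1) q.1 :=
    ((F.contDiff_localMap h).differentiable (by simp) q.1).hasFDerivAt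
  exact (h1.comp q hasFDerivAt_fst).add
    ((Complex.reCLM.smulRight a + Complex.imCLM.smulRight b).hasFDerivAt.comp q hasFDerivAt_snd)

/-- The orientation determinant of the tubular parametrization. -/
def tubeDet (x : ℂ) : ℝ :=
  det4 (fderiv ℝ (F.localMap h) x 1) (fderiv ℝ (F.localMap h) x Complex.I) a b

theorem continuous_tubeDet : Continuous (F.tubeDet h a b) := by
  have h1 : Continuous (fderiv ℝ (F.localMap h)) :=
    (F.contDiff_localMap h).continuous_fderiv (by simp)
  unfold tubeDet
  simp only [det4_eq]
  fun_prop

variable {a b}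

theorem tubeDeriv_injective {x : ℂ} (hx : F.tubeDet h a b x ≠ 0) :
    Function.Injective (F.tubeDeriv h a b x) := by
  rw [injective_iff_map_eq_zero]
  intro q hq
  rw [tubeDeriv_apply] at hq
  obtain ⟨h1, h2, h3, h4⟩ := eq_zero_of_det4_ne_zero hx hq
  exact Prod.ext (Complex.ext h1 h2) (Complex.ext h3 h4)

/-- The differential of the tubular parametrization as an isomorphism. -/
def tubeDerivEquiv {x : ℂ} (hx : F.tubeDet h a b x ≠ 0) : (ℂ × ℂ) ≃L[ℝ] R4 :=
  (LinearMap.linearEquivOfInjective (F.tubeDeriv h a b x).toLinearMap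
    (F.tubeDeriv_injective h hx) (by simp)).toContinuousLinearEquiv

theorem coe_tubeDerivEquiv {x : ℂ} (hx : F.tubeDet h a b x ≠ 0) :
    (F.tubeDerivEquiv h hx : ℂ × ℂ →L[ℝ] R4) = F.tubeDeriv h a b x := by
  ext : 1 <;> rfl

theorem isPositiveBasis_chart (hpos : 0 < ((F.sign : ℤ) : ℝ) * det3 s e₁ e₂) (x : ℂ) :
    F.IsPositiveBasis (SphereFrame.chart h x)
      (mfderiv 𝓘(ℝ, ℂ) (𝓡 2) (SphereFrame.chart h) x (1 : ℂ))
      (mfderiv 𝓘(ℝ, ℂ) (𝓡 2) (SphereFrame.chart h) x Complex.I) := by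
  rw [IsPositiveBasis, SphereFrame.sphereDet_chart, mul_left_comm]
  exact mul_pos (pow_pos (inv_pos.2 (norm_pos_iff.2 (SphereFrame.point_ne_zero h x))) 3) hpos

/-- Two positive bases of the tangent plane differ by a matrix of positive determinant, so the sign
computed in the chart frame holds for every positive basis. -/
theorem det4_pos_of_isPositiveBasis (hpos : 0 < ((F.sign : ℤ) : ℝ) * det3 s e₁ e₂) {x : ℂ}
    (hx : 0 < F.tubeDet h a b x) {u v : TangentSpace (𝓡 2) (SphereFrame.chart h x)}
    (huv : F.IsPositiveBasis (SphereFrame.chart h x) u v) :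
    0 < det4 (mfderiv (𝓡 2) 𝓘(ℝ, R4) F.toFun (SphereFrame.chart h x) u)
      (mfderiv (𝓡 2) 𝓘(ℝ, R4) F.toFun (SphereFrame.chart h x) v) a b := by
  obtain ⟨z, rfl⟩ := (SphereFrame.mfderiv_chart_bijective h x).2 u
  obtain ⟨w, rfl⟩ := (SphereFrame.mfderiv_chart_bijective h x).2 v
  have h1 := F.isPositiveBasis_chart h hpos x
  change ℂ at z w
  rw [IsPositiveBasis] at h1 huv
  have hz := ContinuousLinearMap.apply_complex
      (mfderiv 𝓘(ℝ, ℂ) (𝓡 2) (SphereFrame.chart h) x : ℂ →L[ℝ] TangentSpace (𝓡 2) _) z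
  have hw := ContinuousLinearMap.apply_complex
      (mfderiv 𝓘(ℝ, ℂ) (𝓡 2) (SphereFrame.chart h) x : ℂ →L[ℝ] TangentSpace (𝓡 2) _) w
  have h2 := sphereDet_comb (SphereFrame.chart h x)
      (mfderiv 𝓘(ℝ, ℂ) (𝓡 2) (SphereFrame.chart h) x (1 : ℂ))
      (mfderiv 𝓘(ℝ, ℂ) (𝓡 2) (SphereFrame.chart h) x Complex.I) z.re z.im w.re w.im
  have h3 : sphereDet (SphereFrame.chart h x)
      (mfderiv 𝓘(ℝ, ℂ) (𝓡 2) (SphereFrame.chart h) x z)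
      (mfderiv 𝓘(ℝ, ℂ) (𝓡 2) (SphereFrame.chart h) x w) = _ :=
    (congrArg₂ (sphereDet (SphereFrame.chart h x)) hz hw).trans h2
  rw [h3, mul_left_comm] at huv
  have h4 := (pos_iff_pos_of_mul_pos huv).2 h1
  rw [← fderiv_localMap, ← fderiv_localMap, ContinuousLinearMap.apply_complex _ z,
    ContinuousLinearMap.apply_complex _ w, det4_comb_left]
  exact mul_pos h4 hx

end TwoKnot

/-! ### Existence of tubular charts and meridian disks. -/

namespace TwoKnot

variable (F : TwoKnot)

theorem injective : Function.Injective F.toFun := F.isSmoothEmbedding.isEmbedding.injective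

/-- A linear map of the plane with positive determinant has the form `z ↦ α z + β z̄` with
`‖β‖ < ‖α‖`. -/
theorem _root_.Complex.exists_eq_conj_form {p q : ℂ} (h : 0 < p.re * q.im - p.im * q.re) :
    ∃ α β : ℂ, ‖β‖ < ‖α‖ ∧
      ∀ z : ℂ, z.re • p + z.im • q = α * z + β * (starRingEnd ℂ) z := by
  -- These are the Wirtinger derivatives; the difference of their squared norms is the determinant.
  refine ⟨(p - Complex.I * q) / 2, (p + Complex.I * q) / 2, ?_, fun z => ?_⟩
  · rw [← sq_lt_sq₀ (norm_nonneg _) (norm_nonneg _), Complex.sq_norm, Complex.sq_norm]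
    simp [Complex.normSq_apply]
    nlinarith
  · apply Complex.ext <;> simp <;> ring

theorem exists_frame (s : S2) : ∃ e₁ e₂ : R3, 0 < ((F.sign : ℤ) : ℝ) * det3 s e₁ e₂ := by
  obtain ⟨a, b, hab⟩ := exists_det3_ne_zero (s := (s : R3)) (ne_zero_of_mem_unit_sphere s)
  have hs : ((F.sign : ℤ) : ℝ) ≠ 0 := by simp
  rcases lt_or_gt_of_ne (mul_ne_zero hs hab) with h | h
  · refine ⟨b, a, ?_⟩
    have : det3 s b a = -det3 s a b := by simp only [det3_eq]; ring
    rw [this, mul_neg]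
    exact neg_pos.2 h
  · exact ⟨a, b, h⟩

theorem _root_.SphereFrame.chart_zero (s : S2) {e₁ e₂ : R3} (h : det3 s e₁ e₂ ≠ 0) :
    SphereFrame.chart h 0 = s := by
  apply Subtype.ext
  rw [SphereFrame.coe_chart]
  simp [SphereFrame.point]

theorem tubeMap_zero (s : S2) {e₁ e₂ : R3} (h : det3 s e₁ e₂ ≠ 0) (a b : R4) :
    F.tubeMap h a b 0 = F.toFun s := by
  simp [tubeMap, localMap, SphereFrame.chart_zero]

/-- Because `F` is a topological embedding, knot points near `F.toFun s` have parameters near `s`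
and lie on the zero section of the tube. Injectivity of the parametrization excludes any other
intersection. -/
theorem exists_ball_tubeMap (s : S2) {e₁ e₂ : R3} (h : det3 s e₁ e₂ ≠ 0) {a b : R4}
    {δ : ℝ} (hδ : 0 < δ) (hinj : Set.InjOn (F.tubeMap h a b) (Metric.ball 0 δ)) :
    ∃ ε, 0 < ε ∧ ε ≤ δ ∧ ∀ q ∈ Metric.ball 0 ε, F.tubeMap h a b q ∈ Set.range F.toFun ↔ q.2 = 0 := by
  obtain ⟨ξ, hξc, hξ0, hξ⟩ := SphereFrame.exists_chart_eq s h
  have hN : ∀ᶠ s' in 𝓝 s, SphereFrame.chart h (ξ s') = s' ∧ ‖ξ s'‖ < δ := by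
    refine hξ.and (hξc.norm.eventually (gt_mem_nhds ?_))
    change ‖ξ s‖ < δ
    rwa [hξ0, norm_zero]
  rw [F.isSmoothEmbedding.isEmbedding.nhds_eq_comap, Filter.eventually_comap,
    ← F.tubeMap_zero s h a b] at hN
  obtain ⟨ε, hε, hball⟩ := Metric.eventually_nhds_iff_ball.1
    ((F.contDiff_tubeMap h a b).continuous.continuousAt.eventually hN)
  refine ⟨min ε δ, lt_min hε hδ, min_le_right _ _, fun q hq => ⟨?_, fun hq0 => ?_⟩⟩
  · rintro ⟨s', hs'⟩
    obtain ⟨h1, h2⟩ := hball q (Metric.ball_subset_ball (min_le_left _ _) hq) s' hs'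
    have h3 : F.tubeMap h a b (ξ s', 0) = F.tubeMap h a b q := by
      rw [← hs']
      simp [tubeMap, localMap, h1]
    have h4 : ((ξ s', 0) : ℂ × ℂ) ∈ Metric.ball 0 δ := by
      simpa [hδ] using h2
    rw [← hinj h4 (Metric.ball_subset_ball (min_le_right _ _) hq) h3]
  · refine ⟨SphereFrame.chart h q.1, ?_⟩
    simp [tubeMap, localMap, hq0]

/-- At every point of the knot there are a tubular chart and a meridian disk. -/
theorem exists_tubeChart_and_disk (s : S2) :
    Nonempty (F.TubeChart s) ∧ ∃ D : F.MeridianDisk, D.center = s := by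
  obtain ⟨e₁, e₂, hpos⟩ := F.exists_frame s
  have h : det3 s e₁ e₂ ≠ 0 := right_ne_zero_of_mul hpos.ne'
  obtain ⟨a, b, hab⟩ := exists_det4_pos (F.linearIndependent_fderiv_localMap h 0)
  change 0 < F.tubeDet h a b 0 at hab
  have hs0 : HasStrictFDerivAt (F.tubeMap h a b)
      (F.tubeDerivEquiv h hab.ne' : ℂ × ℂ →L[ℝ] R4) 0 := by
    rw [coe_tubeDerivEquiv]
    exact ((F.contDiff_tubeMap h a b).contDiffAt.hasStrictFDerivAt' (F.hasFDerivAt_tubeMap h a b 0)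
      (by simp))
  let Θ := hs0.toOpenPartialHomeomorph (F.tubeMap h a b)
  have hΘ : ⇑Θ = F.tubeMap h a b := rfl
  have h0 : (0 : ℂ × ℂ) ∈ Θ.source := hs0.mem_toOpenPartialHomeomorph_source
  have hdet : ∀ᶠ q : ℂ × ℂ in 𝓝 0, 0 < F.tubeDet h a b q.1 :=
    ((F.continuous_tubeDet h a b).comp continuous_fst).continuousAt.eventually (lt_mem_nhds hab)
  obtain ⟨δ, hδ, hball⟩ := Metric.eventually_nhds_iff_ball.1
    (hdet.and (Θ.open_source.mem_nhds h0))
  have hinj : Set.InjOn (F.tubeMap h a b) (Metric.ball 0 δ) :=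
    Θ.injOn.mono fun q hq => (hball q hq).2
  obtain ⟨ε, hε, hεδ, htube⟩ := F.exists_ball_tubeMap s h hδ hinj
  have hsub : Metric.ball (0 : ℂ × ℂ) ε ⊆ Metric.ball 0 δ := Metric.ball_subset_ball hεδ
  -- The meridian disk is the normal fibre over `s`, scaled by `ε / 2` so that the closed unit disk
  -- stays in the tube.
  refine ⟨⟨⟨Θ, ε, hε, fun q hq => (hball q (hsub hq)).2, F.tubeMap_zero s h a b, htube, ?_⟩⟩,
    ⟨⟨fun z => F.tubeMap h a b (0, (ε / 2) • z), ?_, s, ?_, ?_, ?_⟩, rfl⟩⟩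
  · rintro D ⟨⟨x, y⟩, hq, hqD⟩
    obtain rfl : y = 0 := (htube _ hq).1 ⟨D.center, hqD.symm⟩
    have hx : 0 < F.tubeDet h a b x := (hball _ (hsub hq)).1
    have hcen : D.center = SphereFrame.chart h x := F.injective (by
      rw [← hqD, hΘ]; simp [tubeMap, localMap])
    have hsymm : Θ.symm (D.toFun 0) = (x, 0) := by
      rw [D.map_zero, ← hqD, Θ.left_inv (hball _ (hsub hq)).2]
    have hd1 : HasFDerivAt Θ.symm ((F.tubeDerivEquiv h hx.ne').symm : R4 →L[ℝ] ℂ × ℂ)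
        (D.toFun 0) := by
      refine Θ.hasFDerivAt_symm ?_ ?_
      · rw [D.map_zero, ← hqD]
        exact Θ.map_source (hball _ (hsub hq)).2
      · rw [hsymm, coe_tubeDerivEquiv]
        exact F.hasFDerivAt_tubeMap h a b (x, 0)
    have hd2 : HasFDerivAt D.toFun (fderiv ℝ D.toFun 0) 0 :=
      (D.contDiff.differentiable (by simp) 0).hasFDerivAt
    have hd3 := (hd1.comp 0 hd2).snd
    set p := (F.tubeDerivEquiv h hx.ne').symm (fderiv ℝ D.toFun 0 1) with hp
    set q := (F.tubeDerivEquiv h hx.ne').symm (fderiv ℝ D.toFun 0 Complex.I) with hq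
    have hap : ∀ v, F.tubeDerivEquiv h hx.ne' v = F.tubeDeriv h a b x v := fun v =>
      DFunLike.congr_fun (F.coe_tubeDerivEquiv h hx.ne') v
    have hp' : fderiv ℝ D.toFun 0 1 = F.tubeDeriv h a b x p := by
      rw [← hap, hp, ContinuousLinearEquiv.apply_symm_apply]
    have hq' : fderiv ℝ D.toFun 0 Complex.I = F.tubeDeriv h a b x q := by
      rw [← hap, hq, ContinuousLinearEquiv.apply_symm_apply]
    -- The tangential components of the disk drop out of the determinant, so positivity of the
    -- intersection is positivity of the normal part of the differential.
    have hpq : 0 < p.2.re * q.2.im - p.2.im * q.2.re := by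
      have h1 := D.positive
      rw [hcen] at h1
      have h2 := h1 _ _ (F.isPositiveBasis_chart h hpos x)
      rw [← fderiv_localMap, ← fderiv_localMap, hp', hq', tubeDeriv_apply, tubeDeriv_apply,
        det4_comb_right] at h2
      exact (pos_iff_pos_of_mul_pos h2).2 hx
    obtain ⟨α, β, hαβ, hform⟩ := Complex.exists_eq_conj_form hpq
    refine ⟨α, β, hαβ, ?_⟩
    have h1 := hd3.isLittleO
    simp only [Function.comp_apply, sub_zero, hsymm] at h1
    refine h1.congr_left fun z => ?_
    rw [ContinuousLinearMap.apply_complex _ z, ← hform]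
    rfl
  · exact (F.contDiff_tubeMap h a b).comp (contDiff_const.prodMk (contDiff_const_smul (ε / 2)))
  · rw [smul_zero]
    exact F.tubeMap_zero s h a b
  · intro z hz hz0
    have hmem : ((0, (ε / 2) • z) : ℂ × ℂ) ∈ Metric.ball 0 ε := by
      simp only [mem_ball_zero_iff, Prod.norm_mk, norm_zero, norm_smul, max_lt_iff]
      refine ⟨hε, ?_⟩
      rw [Real.norm_of_nonneg (by positivity)]
      nlinarith
    rw [htube _ hmem]
    exact smul_ne_zero (by positivity) hz0
  · intro u v huv
    have hder : HasFDerivAt (fun z : ℂ => F.tubeMap h a b (0, (ε / 2) • z))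
        ((F.tubeDeriv h a b 0).comp ((0 : ℂ →L[ℝ] ℂ).prod
          ((ε / 2) • ContinuousLinearMap.id ℝ ℂ))) 0 := by
      have h1 := F.hasFDerivAt_tubeMap h a b ((0, (ε / 2) • (0 : ℂ)) : ℂ × ℂ)
      exact h1.comp (0 : ℂ) ((hasFDerivAt_const (0 : ℂ) (0 : ℂ)).prodMk
        ((hasFDerivAt_id (𝕜 := ℝ) (0 : ℂ)).const_smul (ε / 2)))
    rw [hder.fderiv]
    have h2 : ∀ u v : TangentSpace (𝓡 2) (SphereFrame.chart h 0),
        F.IsPositiveBasis (SphereFrame.chart h 0) u v →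
        0 < det4 (mfderiv (𝓡 2) 𝓘(ℝ, R4) F.toFun (SphereFrame.chart h 0) u)
          (mfderiv (𝓡 2) 𝓘(ℝ, R4) F.toFun (SphereFrame.chart h 0) v) a b := fun u v huv =>
      F.det4_pos_of_isPositiveBasis h hpos hab huv
    rw [SphereFrame.chart_zero] at h2
    have h3 := h2 u v huv
    have h4 : ∀ u v : R4, det4 u v
        (((F.tubeDeriv h a b 0).comp ((0 : ℂ →L[ℝ] ℂ).prod
          ((ε / 2) • ContinuousLinearMap.id ℝ ℂ))) 1)
        (((F.tubeDeriv h a b 0).comp ((0 : ℂ →L[ℝ] ℂ).prod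
          ((ε / 2) • ContinuousLinearMap.id ℝ ℂ))) Complex.I) = (ε / 2) ^ 2 * det4 u v a b := by
      intro u v
      rw [ContinuousLinearMap.comp_apply, ContinuousLinearMap.comp_apply, tubeDeriv_apply,
        tubeDeriv_apply]
      simp only [det4_eq]
      simp
      ring
    exact (mul_pos (by positivity) h3).trans_eq (h4 _ _).symm

end TwoKnot

/-! ### Connectedness of the complement, and cocycles on meridians and loops. -/

namespace TwoKnot

variable (F : TwoKnot)

/-- The cone over the knot with apex `a`. -/
def cone (a : R4) : Set R4 := {c | ∃ (s : S2) (r : ℝ), c = a + r • (F.toFun s - a)}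

/-- Countably many charts cover the sphere, so the cone is a countable union of smooth images of
subsets of `ℝ × ℂ`, which has dimension `3`. -/
theorem dimH_cone_le (a : R4) : dimH (F.cone a) ≤ 3 := by
  have hframe : ∀ s : S2, ∃ e : R3 × R3, det3 s e.1 e.2 ≠ 0 := fun s => by
    obtain ⟨e₁, e₂, he⟩ := exists_det3_ne_zero (s := (s : R3)) (ne_zero_of_mem_unit_sphere s)
    exact ⟨(e₁, e₂), he⟩
  choose e he using hframe
  have hnhds : ∀ s : S2, Set.range (SphereFrame.chart (he s)) ∈ 𝓝 s := fun s => by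
    obtain ⟨ξ, -, -, hξ⟩ := SphereFrame.exists_chart_eq s (he s)
    filter_upwards [hξ] with s' hs'
    exact ⟨_, hs'⟩
  obtain ⟨t, htc, ht⟩ := TopologicalSpace.countable_cover_nhds hnhds
  have hsub : F.cone a ⊆ ⋃ s ∈ t, Set.range fun q : ℝ × ℂ =>
      a + q.1 • (F.localMap (he s) q.2 - a) := by
    rintro c ⟨s, r, rfl⟩
    have hs : s ∈ ⋃ x ∈ t, Set.range (SphereFrame.chart (he x)) := ht ▸ Set.mem_univ s
    obtain ⟨s', hs', x, rfl⟩ := Set.mem_iUnion₂.1 hs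
    exact Set.mem_iUnion₂.2 ⟨s', hs', (r, x), rfl⟩
  refine (dimH_mono hsub).trans ?_
  rw [dimH_bUnion htc]
  refine iSup₂_le fun s _ => ?_
  have hcd : ContDiff ℝ 1 fun q : ℝ × ℂ => a + q.1 • (F.localMap (he s) q.2 - a) :=
    contDiff_const.add (contDiff_fst.smul
      ((((F.contDiff_localMap (he s)).of_le (by simp)).comp contDiff_snd).sub contDiff_const))
  refine hcd.dimH_range_le.trans ?_
  norm_num [Module.finrank_prod]

/-- If the segment met the knot at a point other than `a`, then `c` would lie on the line from `a`
through that point, hence in the cone. -/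
theorem segment_notMem {a c : R4} (ha : a ∉ Set.range F.toFun) (hc : c ∉ F.cone a) {y : R4}
    (hy : y ∈ segment ℝ a c) : y ∉ Set.range F.toFun := by
  rintro ⟨s, rfl⟩
  rw [segment_eq_image'] at hy
  obtain ⟨θ, -, hθ⟩ := hy
  rcases eq_or_ne θ 0 with rfl | hθ0
  · exact ha ⟨s, by simpa using hθ.symm⟩
  · refine hc ⟨s, θ⁻¹, ?_⟩
    rw [← hθ]
    simp [smul_smul, hθ0]

theorem joinedIn_of_segment {W : Set R4} (hW : Convex ℝ W) {a c : F.Complement}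
    (ha : a.1 ∈ W) (hcW : c.1 ∈ W) (hc : c.1 ∉ F.cone a) :
    JoinedIn (Subtype.val ⁻¹' W) a c := by
  obtain ⟨p, hp⟩ := JoinedIn.of_segment_subset (x := a.1) (y := c.1) subset_rfl
  refine ⟨⟨⟨fun t => ⟨p t, F.segment_notMem a.2 hc (hp t)⟩, by fun_prop⟩, ?_, ?_⟩, fun t => ?_⟩
  · exact Subtype.ext p.source
  · exact Subtype.ext p.target
  · exact hW.segment_subset ha hcW (hp t)

/-- A knot of codimension two does not disconnect open convex sets. -/
theorem joinedIn_complement (W : Set R4) (hWo : IsOpen W) (hW : Convex ℝ W) (a b : F.Complement)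
    (ha : a.1 ∈ W) (hb : b.1 ∈ W) : JoinedIn (Subtype.val ⁻¹' W) a b := by
  -- Both cones have Hausdorff dimension less than `4`, so `W` contains a point `c` off the knot and
  -- off both cones; the segments `a c` and `c b` then avoid the knot.
  have hdense : Dense (F.cone a ∪ F.cone b)ᶜ := by
    apply dense_compl_of_dimH_lt_finrank
    rw [dimH_union]
    refine (max_le (F.dimH_cone_le a) (F.dimH_cone_le b)).trans_lt ?_
    norm_num
  have hclosed : IsClosed (Set.range F.toFun) :=
    (isCompact_range F.contMDiff.continuous).isClosed
  obtain ⟨c, hc, hcW, hcF⟩ :=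
    hdense.exists_mem_open (hWo.inter hclosed.isOpen_compl) ⟨a, ha, a.2⟩
  rw [Set.mem_compl_iff, Set.mem_union, not_or] at hc
  exact (F.joinedIn_of_segment hW (c := ⟨c, hcF⟩) ha hcW hc.1).trans
    (F.joinedIn_of_segment hW (c := ⟨c, hcF⟩) hb hcW hc.2).symm

theorem pathConnectedSpace_complement [Nonempty F.Complement] : PathConnectedSpace F.Complement :=
  ⟨inferInstance, fun a b => (F.joinedIn_complement Set.univ isOpen_univ convex_univ a b trivial
    trivial).joined⟩

variable {A : Type*} [AddCommGroup A]

/-- All positive meridian disks have the same value under a cocycle. -/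
theorem val_boundary_eq (c : PathCocycle F.Complement A) (D D' : F.MeridianDisk) :
    c.val D.boundary = c.val D'.boundary := by
  have hex : ∀ s, ∃ k : A, ∀ᶠ s' in 𝓝 s, ∀ D : F.MeridianDisk, D.center = s' →
      c.val D.boundary = k := fun s => by
    obtain ⟨⟨Θ⟩, -⟩ := F.exists_tubeChart_and_disk s
    obtain ⟨k, hk, -⟩ := Θ.exists_val_boundary_eq c
    refine ⟨k, ?_⟩
    filter_upwards [F.contMDiff.continuous.continuousAt.eventually
      (Θ.isOpen_image.mem_nhds Θ.mem_image)] with s' hs' D hD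
    exact hk D (hD ▸ hs')
  choose disk hdisk using fun s => (F.exists_tubeChart_and_disk s).2
  have hval : ∀ s, ∀ᶠ s' in 𝓝 s, ∀ D : F.MeridianDisk, D.center = s' →
      c.val D.boundary = c.val (disk s).boundary := fun s => by
    obtain ⟨k, hk⟩ := hex s
    rw [hk.self_of_nhds (disk s) (hdisk s)]
    exact hk
  -- Within one tubular chart the value is constant, and the sphere is connected.
  have hloc : IsLocallyConstant fun s => c.val (disk s).boundary := by
    rw [IsLocallyConstant.iff_eventually_eq]
    intro s
    filter_upwards [hval s] with s' hs'
    exact hs' _ (hdisk s')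
  have : PreconnectedSpace S2 := Subtype.preconnectedSpace
    (isPreconnected_sphere (by rw [← Module.finrank_eq_rank]; norm_num) _ _)
  rw [(hval D.center).self_of_nhds D rfl, (hval D'.center).self_of_nhds D' rfl]
  exact hloc.apply_eq_of_preconnectedSpace _ _

/-- A cocycle that vanishes on a positive meridian vanishes on all loops. -/
theorem val_loop_eq_zero (c : PathCocycle F.Complement A) (D : F.MeridianDisk)
    (hD : c.val D.boundary = 0) {a : F.Complement} (p : Path a a) : c.val p = 0 := by
  refine PathCocycle.val_loop_eq_zero F.joinedIn_complement c (fun y => ?_) p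
  have hclosed : IsClosed (Set.range F.toFun) :=
    (isCompact_range F.contMDiff.continuous).isClosed
  by_cases hy : y ∈ Set.range F.toFun
  · obtain ⟨s, rfl⟩ := hy
    obtain ⟨⟨Θ⟩, D', hD'⟩ := F.exists_tubeChart_and_disk s
    obtain ⟨k, hk, hk0⟩ := Θ.exists_val_boundary_eq c
    -- The vanishing on `D` is carried to this tube by the equality of all meridian values. Off the
    -- knot, a ball in the complement is simply connected.
    have h0 : k = 0 := by
      rw [← hk D' (hD' ▸ Θ.mem_image), F.val_boundary_eq c D' D, hD]
    obtain ⟨ε, hε, hball⟩ := Metric.isOpen_iff.1 Θ.isOpen_image _ Θ.mem_image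
    exact ⟨_, Metric.isOpen_ball, convex_ball _ _,
      Set.singleton_subset_iff.2 (Metric.mem_ball_self hε), (hk0 h0).mono fun x hx => hball hx⟩
  · obtain ⟨ε, hε, hball⟩ := Metric.isOpen_iff.1 hclosed.isOpen_compl _ hy
    refine ⟨_, Metric.isOpen_ball, convex_ball y ε,
      Set.singleton_subset_iff.2 (Metric.mem_ball_self hε), ?_⟩
    have := (convex_ball y ε).contractibleSpace ⟨y, Metric.mem_ball_self hε⟩
    let e : C(Metric.ball y ε, F.Complement) := ⟨fun z => ⟨z, hball z.2⟩, by fun_prop⟩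
    obtain ⟨g, hg⟩ := (c.comap e).exists_potential
    classical
    refine ⟨fun z => if h : z.1 ∈ Metric.ball y ε then g ⟨z, h⟩ else 0, fun a b p hp => ?_⟩
    have ha : a.1 ∈ Metric.ball y ε := by simpa using hp 0
    have hb : b.1 ∈ Metric.ball y ε := by simpa using hp 1
    let q : Path (⟨a, ha⟩ : Metric.ball y ε) ⟨b, hb⟩ :=
      { toFun := fun t => ⟨p t, hp t⟩
        continuous_toFun := by fun_prop
        source' := Subtype.ext (congrArg (fun z : F.Complement => z.1) p.source)
        target' := Subtype.ext (congrArg (fun z : F.Complement => z.1) p.target) }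
    have h1 := hg _ _ q
    rw [PathCocycle.comap_val, c.val_congr (q.map e.continuous) p fun t => rfl] at h1
    simp only [dif_pos ha, dif_pos hb]
    exact h1

end TwoKnot

/-! ### The cocycle with values in the abelianized fundamental group -/

namespace PathCocycle

variable {X A B : Type*} [TopologicalSpace X] [AddCommGroup A] [AddCommGroup B]

/-- The change of coefficients of a cocycle. -/
def mapCoeff (c : PathCocycle X A) (f : A →+ B) : PathCocycle X B where
  val p := f (c.val p)
  val_trans p q := by rw [c.val_trans, map_add]
  val_homotopic h := by rw [c.val_homotopic h]

theorem val_trans_trans_symm (c : PathCocycle X A) {a b : X} (p : Path a b) (q : Path b b) :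
    c.val (p.trans (q.trans p.symm)) = c.val q := by
  rw [c.val_trans, c.val_trans, c.val_symm]
  abel

/-- The element of the fundamental group given by a path whose ends are joined to the base point
by standard paths. -/
def closeUp [PathConnectedSpace X] (x : X) {a b : X} (P : Path.Homotopic.Quotient a b) :
    FundamentalGroup X x :=
  FundamentalGroup.fromPath (((Path.Homotopic.Quotient.mk (PathConnectedSpace.somePath x a)).trans P).trans
    (Path.Homotopic.Quotient.mk (PathConnectedSpace.somePath x b)).symm)

/-- The two copies of the standard path to `b` cancel. The factors are reversed because `p * q` runs
through `q` first. -/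
theorem closeUp_trans [PathConnectedSpace X] (x : X) {a b d : X}
    (P : Path.Homotopic.Quotient a b) (Q : Path.Homotopic.Quotient b d) :
    closeUp x (P.trans Q) = closeUp x Q * closeUp x P := by
  rw [FundamentalGroup.mul_def]
  simp only [closeUp]
  generalize Path.Homotopic.Quotient.mk (PathConnectedSpace.somePath x a) = qa
  generalize Path.Homotopic.Quotient.mk (PathConnectedSpace.somePath x b) = qb
  generalize Path.Homotopic.Quotient.mk (PathConnectedSpace.somePath x d) = qd
  change _ = Path.Homotopic.Quotient.trans ((qa.trans P).trans qb.symm) ((qb.trans Q).trans qd.symm)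
  rw [Path.Homotopic.Quotient.trans_assoc (qa.trans P), ← Path.Homotopic.Quotient.trans_assoc qb.symm,
    ← Path.Homotopic.Quotient.trans_assoc qb.symm, Path.Homotopic.Quotient.symm_trans, Path.Homotopic.Quotient.refl_trans,
    ← Path.Homotopic.Quotient.trans_assoc, ← Path.Homotopic.Quotient.trans_assoc]

/-- The tautological cocycle with values in the abelianized fundamental group. -/
def hurewicz (X : Type*) [TopologicalSpace X] [PathConnectedSpace X] (x : X) :
    PathCocycle X (Additive (Abelianization (FundamentalGroup X x))) where
  val p := Additive.ofMul (Abelianization.of (closeUp x (Path.Homotopic.Quotient.mk p)))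
  val_trans p q := by
    rw [Path.Homotopic.Quotient.mk_trans, closeUp_trans, map_mul, mul_comm]
    rfl
  val_homotopic h := by rw [Path.Homotopic.Quotient.eq.2 h]

/-- The standard path from `x` to itself need not be constant, so closing up conjugates the loop;
this disappears in the abelianization. -/
theorem hurewicz_val_loop [PathConnectedSpace X] (x : X) (p : Path x x) :
    (hurewicz X x).val p =
      Additive.ofMul (Abelianization.of (FundamentalGroup.fromPath (Path.Homotopic.Quotient.mk p))) := by
  change Additive.ofMul (Abelianization.of (closeUp x (Path.Homotopic.Quotient.mk p))) = _
  congr 1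
  let r : FundamentalGroup X x :=
    FundamentalGroup.fromPath (Path.Homotopic.Quotient.mk (PathConnectedSpace.somePath x x))
  have : closeUp x (Path.Homotopic.Quotient.mk p) = r⁻¹ * (FundamentalGroup.fromPath (Path.Homotopic.Quotient.mk p) * r) := rfl
  rw [this, map_mul, map_mul, mul_comm, mul_assoc, map_inv, mul_inv_cancel, mul_one]

end PathCocycle

/-- The endomorphism of the fundamental group at `x` induced by a homeomorphism and a path from
`x` to its image. -/
def FundamentalGroup.twist {X : Type*} [TopologicalSpace X] (h : X ≃ₜ X) {x : X}
    (r : Path (h x) x) : FundamentalGroup X x →* FundamentalGroup X x :=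
  (FundamentalGroup.fundamentalGroupMulEquivOfPath r).toMonoidHom.comp
    (FundamentalGroup.map (h : C(X, X)) x)

theorem FundamentalGroup.twist_fromPath {X : Type*} [TopologicalSpace X] (h : X ≃ₜ X) {x : X}
    (r : Path (h x) x) (p : Path x x) :
    twist h r (FundamentalGroup.fromPath (Path.Homotopic.Quotient.mk p)) = FundamentalGroup.fromPath
      (Path.Homotopic.Quotient.mk (r.symm.trans ((p.map h.continuous).trans r.symm.symm))) := by
  rw [Path.symm_symm]
  rfl

theorem FundamentalGroup.twist_surjective {X : Type*} [TopologicalSpace X] (h : X ≃ₜ X) {x : X}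
    (r : Path (h x) x) : Function.Surjective (twist h r) := by
  refine (FundamentalGroup.fundamentalGroupMulEquivOfPath r).surjective.comp fun P => ?_
  induction P using Path.Homotopic.Quotient.ind with
  | mk p =>
    refine ⟨FundamentalGroup.fromPath (Path.Homotopic.Quotient.mk
      ((p.map h.symm.continuous).cast (h.symm_apply_apply x).symm (h.symm_apply_apply x).symm)), ?_⟩
    change Path.Homotopic.Quotient.mk _ = Path.Homotopic.Quotient.mk p
    congr 1
    ext t
    simp

/-! ### Meridians in the abelianized knot group. -/

namespace TwoKnot

variable (F : TwoKnot)

theorem of_isMeridian [PathConnectedSpace F.Complement] {x : F.Complement} (D : F.MeridianDisk)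
    (γ : Path x (D.boundaryPoint 0)) :
    Additive.ofMul (Abelianization.of (FundamentalGroup.fromPath
      (Path.Homotopic.Quotient.mk (γ.trans (D.boundary.trans γ.symm))))) =
        (PathCocycle.hurewicz F.Complement x).val D.boundary := by
  rw [← PathCocycle.hurewicz_val_loop, PathCocycle.val_trans_trans_symm]

/-- A meridian generates the abelianized knot group. -/
theorem exists_zpow_of_isMeridian [PathConnectedSpace F.Complement] {x : F.Complement}
    {μ : FundamentalGroup F.Complement x} (hμ : F.IsMeridian x μ)
    (g : FundamentalGroup F.Complement x) :
    ∃ n : ℤ, Abelianization.of g = Abelianization.of μ ^ n := by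
  obtain ⟨D, γ, rfl⟩ := hμ
  have h1 := F.of_isMeridian D γ
  set μ := FundamentalGroup.fromPath
      (Path.Homotopic.Quotient.mk (γ.trans (D.boundary.trans γ.symm)))
  induction g using Path.Homotopic.Quotient.ind with
  | mk p =>
    -- Modulo the subgroup generated by `μ` the tautological cocycle vanishes on a meridian, hence
    -- on every loop.
    let c := (PathCocycle.hurewicz F.Complement x).mapCoeff
      (QuotientAddGroup.mk' (AddSubgroup.zmultiples (Additive.ofMul (Abelianization.of μ))))
    have hD : c.val D.boundary = 0 := by
      change QuotientAddGroup.mk' _ ((PathCocycle.hurewicz F.Complement x).val D.boundary) = 0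
      rw [← h1, QuotientAddGroup.mk'_apply, QuotientAddGroup.eq_zero_iff]
      exact AddSubgroup.mem_zmultiples _
    have h2 : QuotientAddGroup.mk' (AddSubgroup.zmultiples (Additive.ofMul (Abelianization.of μ)))
      ((PathCocycle.hurewicz F.Complement x).val p) = 0 := F.val_loop_eq_zero c D hD p
    rw [PathCocycle.hurewicz_val_loop, QuotientAddGroup.mk'_apply,
      QuotientAddGroup.eq_zero_iff] at h2
    obtain ⟨n, hn⟩ := AddSubgroup.mem_zmultiples_iff.1 h2
    exact ⟨n, hn.symm⟩

end TwoKnot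

/-! ### Orientations under an ambient isotopy to the reverse. -/

theorem det4_map (L : R4 →L[ℝ] R4) (a b c d : R4) :
    det4 (L a) (L b) (L c) (L d) = L.det * det4 a b c d := by
  have h : ∀ v : Fin 4 → R4, (EuclideanSpace.basisFun (Fin 4) ℝ).toBasis.det v =
      det4 (v 0) (v 1) (v 2) (v 3) := fun v => by
    rw [Module.Basis.det_apply, ← Matrix.det_transpose, det4]
    congr 1
    ext i j
    fin_cases i <;> rfl
  have h1 := Module.Basis.det_comp (EuclideanSpace.basisFun (Fin 4) ℝ).toBasis L.toLinearMap
    ![a, b, c, d]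
  rw [h, h] at h1
  exact h1

/-- The diffeomorphisms of an ambient isotopy preserve the orientation. -/
theorem AmbientIsotopy.det_pos (H : AmbientIsotopy) (t : ℝ) (y : R4) :
    0 < (fderiv ℝ (H.map t) y).det := by
  have hcont : Continuous fun t : ℝ => (fderiv ℝ (H.map t) y).det := by
    refine ContinuousLinearMap.continuous_det.comp ?_
    have h1 : ∀ t, fderiv ℝ (H.map t) y =
        (fderiv ℝ (fun q : ℝ × R4 => H.map q.1 q.2) (t, y)).comp
          (ContinuousLinearMap.inr ℝ ℝ R4) := fun t => by
      have h2 : HasFDerivAt (fun q : ℝ × R4 => H.map q.1 q.2)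
          (fderiv ℝ (fun q : ℝ × R4 => H.map q.1 q.2) (t, y)) (t, y) :=
        (H.contDiff.differentiable (by simp) _).hasFDerivAt
      exact (h2.comp y (hasFDerivAt_prodMk_right t y)).fderiv
    simp only [h1]
    have h3 : Continuous (fderiv ℝ (fun q : ℝ × R4 => H.map q.1 q.2)) :=
      H.contDiff.continuous_fderiv (by simp)
    exact (h3.comp (by fun_prop : Continuous fun t : ℝ => (t, y))).clm_comp continuous_const
  have hne : ∀ t, (fderiv ℝ (H.map t) y).det ≠ 0 := fun t h0 => by
    let e : R4 ≃L[ℝ] R4 := (H.map t).mfderivToContinuousLinearEquiv (by simp) y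
    have h1 : fderiv ℝ (H.map t) y = (e : R4 →L[ℝ] R4) := by
      rw [← mfderiv_eq_fderiv]
      rfl
    rw [h1] at h0
    exact (LinearEquiv.isUnit_det' e.toLinearEquiv).ne_zero h0
  have h0 : (fderiv ℝ (H.map 0) y).det = 1 := by
    have : (H.map 0 : R4 → R4) = id := funext H.map_zero
    rw [this, fderiv_id]
    exact LinearMap.det_id
  -- The determinant is continuous in time, never zero and equal to `1` at time `0`; a nonpositive
  -- value would force a zero.
  by_contra hneg
  obtain ⟨s, hs⟩ := mem_range_of_exists_le_of_exists_ge hcont ⟨t, not_lt.1 hneg⟩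
    ⟨0, by rw [h0]; exact zero_le_one⟩
  exact hne s hs

namespace TwoKnot

variable {F : TwoKnot}

/-- Alternating 2-forms on a plane form a line, so the pullback of the area form is a multiple of
the area form. -/
theorem exists_sphereDet_map {s s' : S2} (L : TangentSpace (𝓡 2) s →L[ℝ] TangentSpace (𝓡 2) s') :
    ∃ k : ℝ, ∀ u v, sphereDet s' (L u) (L v) = k * sphereDet s u v := by
  obtain ⟨e₁, e₂, h⟩ := exists_det3_ne_zero (s := (s : R3)) (ne_zero_of_mem_unit_sphere s)
  obtain ⟨u, v, huv, hspan⟩ : ∃ u v : TangentSpace (𝓡 2) s, sphereDet s u v ≠ 0 ∧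
      ∀ w : TangentSpace (𝓡 2) s, ∃ p q : ℝ, w = p • u + q • v := by
    have h1 := SphereFrame.sphereDet_chart_ne_zero h 0
    have h2 : ∀ w, ∃ p q : ℝ, w =
        p • mfderiv 𝓘(ℝ, ℂ) (𝓡 2) (SphereFrame.chart h) 0 (1 : ℂ) +
        q • mfderiv 𝓘(ℝ, ℂ) (𝓡 2) (SphereFrame.chart h) 0 Complex.I := fun w => by
      obtain ⟨z, rfl⟩ := (SphereFrame.mfderiv_chart_bijective h 0).2 w
      change ℂ at z
      exact ⟨z.re, z.im, ContinuousLinearMap.apply_complex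
        (mfderiv 𝓘(ℝ, ℂ) (𝓡 2) (SphereFrame.chart h) 0 : ℂ →L[ℝ] TangentSpace (𝓡 2) _) z⟩
    have h3 : ∃ u v : TangentSpace (𝓡 2) (SphereFrame.chart h 0),
        sphereDet (SphereFrame.chart h 0) u v ≠ 0 ∧
        ∀ w : TangentSpace (𝓡 2) (SphereFrame.chart h 0), ∃ p q : ℝ, w = p • u + q • v :=
      ⟨_, _, h1, h2⟩
    rwa [SphereFrame.chart_zero] at h3
  refine ⟨sphereDet s' (L u) (L v) / sphereDet s u v, fun x y => ?_⟩
  obtain ⟨p, q, rfl⟩ := hspan x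
  obtain ⟨p', q', rfl⟩ := hspan y
  simp only [map_add, map_smul]
  rw [sphereDet_comb, sphereDet_comb]
  field_simp

theorem exists_isPositiveBasis (F : TwoKnot) (s : S2) : ∃ u v, F.IsPositiveBasis s u v := by
  obtain ⟨e₁, e₂, hpos⟩ := F.exists_frame s
  have h : det3 s e₁ e₂ ≠ 0 := right_ne_zero_of_mul hpos.ne'
  have h1 : ∃ u v, F.IsPositiveBasis (SphereFrame.chart h 0) u v :=
    ⟨_, _, F.isPositiveBasis_chart h hpos 0⟩
  rwa [SphereFrame.chart_zero] at h1

theorem isPositiveBasis_swap {s : S2} {u v : TangentSpace (𝓡 2) s} :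
    F.IsPositiveBasis s v u ↔ ((F.sign : ℤ) : ℝ) * sphereDet s u v < 0 := by
  have h : sphereDet s v u = -sphereDet s u v := by
    simpa using sphereDet_comb s u v 0 1 1 0
  rw [IsPositiveBasis, h, mul_neg, neg_pos]

/-- If a diffeomorphism reverses the orientation of a knot, the preimage of a positive basis is
negative. -/
theorem isPositiveBasis_of_reverse {φ : S2 ≃ₘ^∞⟮𝓡 2, 𝓡 2⟯ S2} {s : S2}
    (hφ : ∀ u v : TangentSpace (𝓡 2) s, F.IsPositiveBasis s u v →
      F.reverse.IsPositiveBasis (φ s) (mfderiv (𝓡 2) (𝓡 2) φ s u) (mfderiv (𝓡 2) (𝓡 2) φ s v))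
    {u v : TangentSpace (𝓡 2) s}
    (huv : F.IsPositiveBasis (φ s) (mfderiv (𝓡 2) (𝓡 2) φ s u) (mfderiv (𝓡 2) (𝓡 2) φ s v)) :
    F.IsPositiveBasis s v u := by
  obtain ⟨k, hk⟩ := exists_sphereDet_map (mfderiv (𝓡 2) (𝓡 2) φ s)
  obtain ⟨u₀, v₀, h₀⟩ := F.exists_isPositiveBasis s
  have h₁ := hφ u₀ v₀ h₀
  rw [IsPositiveBasis, hk] at h₁ huv
  rw [IsPositiveBasis] at h₀
  rw [isPositiveBasis_swap]
  have hs : ((F.reverse.sign : ℤ) : ℝ) = -((F.sign : ℤ) : ℝ) := by simp [reverse]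
  rw [hs] at h₁
  have hk0 : k < 0 := by
    by_contra hk0
    nlinarith [mul_nonneg (not_lt.1 hk0) h₀.le]
  by_contra hneg
  nlinarith [mul_nonneg (neg_nonneg.2 hk0.le) (not_lt.1 hneg)]

section Invertible

variable {H : AmbientIsotopy} {φ : S2 ≃ₘ^∞⟮𝓡 2, 𝓡 2⟯ S2}

theorem map_mem_range_iff (hHφ : ∀ s, H.map 1 (F.toFun s) = F.toFun (φ s)) (y : R4) :
    H.map 1 y ∈ Set.range F.toFun ↔ y ∈ Set.range F.toFun := by
  constructor
  · rintro ⟨s, hs⟩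
    refine ⟨φ.symm s, (H.map 1).injective ?_⟩
    change H.map 1 _ = H.map 1 y
    rw [hHφ, φ.apply_symm_apply, hs]
  · rintro ⟨s, rfl⟩
    exact ⟨φ s, (hHφ s).symm⟩

/-- The homeomorphism of the knot complement given by an ambient isotopy to the reverse. -/
def complementHomeomorph (hHφ : ∀ s, H.map 1 (F.toFun s) = F.toFun (φ s)) :
    F.Complement ≃ₜ F.Complement :=
  (H.map 1).toHomeomorph.subtype fun y => (not_congr (map_mem_range_iff hHφ y)).symm

/-- The image of a meridian disk under an isotopy to the reverse, with the orientation changed. -/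
def MeridianDisk.flip (D : F.MeridianDisk) (hHφ : ∀ s, H.map 1 (F.toFun s) = F.toFun (φ s))
    (hφ : ∀ (s : S2) (u v : TangentSpace (𝓡 2) s), F.IsPositiveBasis s u v →
      F.reverse.IsPositiveBasis (φ s) (mfderiv (𝓡 2) (𝓡 2) φ s u)
        (mfderiv (𝓡 2) (𝓡 2) φ s v)) : F.MeridianDisk where
  toFun z := H.map 1 (D.toFun ((starRingEnd ℂ) z))
  contDiff := (H.map 1).contMDiff.contDiff.comp (D.contDiff.comp Complex.conjCLE.contDiff)
  center := φ D.center
  map_zero := by rw [_root_.map_zero, D.map_zero, hHφ]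
  notMem z hz hz0 := by
    rw [map_mem_range_iff hHφ]
    exact D.notMem _ (by rwa [RCLike.norm_conj]) (by simpa using hz0)
  positive u v huv := by
    obtain ⟨u, rfl⟩ := (φ.mfderivToContinuousLinearEquiv (by simp) D.center).surjective u
    obtain ⟨v, rfl⟩ := (φ.mfderivToContinuousLinearEquiv (by simp) D.center).surjective v
    -- Two signs cancel: `φ` reverses the orientation of the tangent plane, whence the order `v`,
    -- `u`, and conjugation replaces `Complex.I` by its negative.
    have h1 := D.positive v u (isPositiveBasis_of_reverse (hφ D.center) huv)
    have hdH : ∀ y, HasFDerivAt (H.map 1) (fderiv ℝ (H.map 1) y) y := fun y =>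
      ((H.map 1).contMDiff.contDiff.differentiable (by simp) y).hasFDerivAt
    have hF : ∀ w : TangentSpace (𝓡 2) D.center,
        (mfderiv (𝓡 2) 𝓘(ℝ, R4) F.toFun (φ D.center) (mfderiv (𝓡 2) (𝓡 2) φ D.center w) : R4) =
        fderiv ℝ (H.map 1) (F.toFun D.center) (mfderiv (𝓡 2) 𝓘(ℝ, R4) F.toFun D.center w) := by
      intro w
      have h2 := mfderiv_comp (I := 𝓡 2) (I' := 𝓡 2) (I'' := 𝓘(ℝ, R4)) D.center
        (g := F.toFun) (f := φ) (F.contMDiff.mdifferentiableAt (by simp))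
        (φ.contMDiff.mdifferentiableAt (by simp))
      have h3 := mfderiv_comp (I := 𝓡 2) (I' := 𝓘(ℝ, R4)) (I'' := 𝓘(ℝ, R4)) D.center
        (g := H.map 1) (f := F.toFun) ((H.map 1).contMDiff.mdifferentiableAt (by simp))
        (F.contMDiff.mdifferentiableAt (by simp))
      have h4 : F.toFun ∘ φ = H.map 1 ∘ F.toFun := funext fun s => (hHφ s).symm
      rw [h4, h3, mfderiv_eq_fderiv] at h2
      exact (DFunLike.congr_fun h2 w).symm
    have hD : HasFDerivAt (fun z => H.map 1 (D.toFun ((starRingEnd ℂ) z)))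
        ((fderiv ℝ (H.map 1) (F.toFun D.center)).comp ((fderiv ℝ D.toFun 0).comp
          (Complex.conjCLE : ℂ →L[ℝ] ℂ))) 0 := by
      have h2 : HasFDerivAt D.toFun (fderiv ℝ D.toFun 0) (Complex.conjCLE (0 : ℂ)) := by
        rw [_root_.map_zero]
        exact (D.contDiff.differentiable (by simp) 0).hasFDerivAt
      have h3 := h2.comp (0 : ℂ) Complex.conjCLE.hasFDerivAt
      have h4 := hdH (D.toFun (Complex.conjCLE (0 : ℂ)))
      rw [_root_.map_zero] at h4
      rw [← D.map_zero]
      exact HasFDerivAt.comp (0 : ℂ) (by rwa [_root_.map_zero]) h3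
    rw [hD.fderiv]
    change 0 < det4
      (mfderiv (𝓡 2) 𝓘(ℝ, R4) F.toFun (φ D.center) (mfderiv (𝓡 2) (𝓡 2) φ D.center u) : R4)
      (mfderiv (𝓡 2) 𝓘(ℝ, R4) F.toFun (φ D.center) (mfderiv (𝓡 2) (𝓡 2) φ D.center v) : R4)
      (fderiv ℝ (H.map 1) (F.toFun D.center) (fderiv ℝ D.toFun 0 ((starRingEnd ℂ) 1)))
      (fderiv ℝ (H.map 1) (F.toFun D.center) (fderiv ℝ D.toFun 0 ((starRingEnd ℂ) Complex.I)))
    have key : ∀ p q : R4, 0 < det4 q p (fderiv ℝ D.toFun 0 1) (fderiv ℝ D.toFun 0 Complex.I) →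
        0 < det4 (fderiv ℝ (H.map 1) (F.toFun D.center) p)
          (fderiv ℝ (H.map 1) (F.toFun D.center) q)
          (fderiv ℝ (H.map 1) (F.toFun D.center) (fderiv ℝ D.toFun 0 ((starRingEnd ℂ) 1)))
          (fderiv ℝ (H.map 1) (F.toFun D.center)
            (fderiv ℝ D.toFun 0 ((starRingEnd ℂ) Complex.I))) := fun p q hpq => by
      rw [det4_map, map_one, Complex.conj_I, map_neg]
      refine mul_pos (H.det_pos 1 _) (hpq.trans_eq ?_)
      simp only [det4_eq, PiLp.neg_apply]
      ring
    rw [hF, hF]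
    exact key _ _ h1

/-- Conjugation of the parameter runs through the boundary circle backwards. -/
theorem val_flip_boundary (D : F.MeridianDisk)
    (hHφ : ∀ s, H.map 1 (F.toFun s) = F.toFun (φ s))
    (hφ : ∀ (s : S2) (u v : TangentSpace (𝓡 2) s), F.IsPositiveBasis s u v →
      F.reverse.IsPositiveBasis (φ s) (mfderiv (𝓡 2) (𝓡 2) φ s u)
        (mfderiv (𝓡 2) (𝓡 2) φ s v))
    {A : Type*} [AddCommGroup A] (c : PathCocycle F.Complement A) :
    c.val (D.boundary.map (complementHomeomorph hHφ).continuous) =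
      -c.val (D.flip hHφ hφ).boundary := by
  rw [← c.val_symm]
  refine c.val_congr _ _ fun t => Subtype.ext ?_
  change H.map 1 (D.toFun (Circle.exp (2 * Real.pi * (t : ℝ)) : ℂ)) =
    H.map 1 (D.toFun ((starRingEnd ℂ) (Circle.exp (2 * Real.pi * (unitInterval.symm t : ℝ)) : ℂ)))
  congr 2
  rw [← Circle.coe_inv_eq_conj, ← Circle.exp_neg, unitInterval.coe_symm_eq,
    show -(2 * Real.pi * (1 - (t : ℝ))) = 2 * Real.pi * t - 2 * Real.pi by ring,
    Circle.periodic_exp.sub_eq]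

end Invertible

end TwoKnot

end

/-! ### Conclusion. -/

theorem mainTheorem9 (F : TwoKnot) (hF : F.IsInvertible)
    (Δ : LaurentPolynomial ℤ) (hΔ : F.IsAlexanderPolynomial Δ) :
    tauInvariant Δ = 0 := by
  obtain ⟨H, φ, hHφ, hφ⟩ := hF
  change ∀ s, H.map 1 (F.toFun s) = F.toFun (φ s) at hHφ
  obtain ⟨x, μ, hμ, hgcd⟩ := hΔ
  have : Nonempty F.Complement := ⟨x⟩
  have : PathConnectedSpace F.Complement := F.pathConnectedSpace_complement
  let h := TwoKnot.complementHomeomorph (F := F) hHφ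
  let r : Path (h x) x := PathConnectedSpace.somePath _ _
  refine tauInvariant_eq_zero_of_isIdealGCD (F.exists_zpow_of_isMeridian hμ)
    (FundamentalGroup.twist_surjective h r) ?_ hgcd
  obtain ⟨D, γ, rfl⟩ := hμ
  let c := PathCocycle.hurewicz F.Complement x
  have h1 := F.of_isMeridian D γ
  rw [FundamentalGroup.twist_fromPath]
  refine Additive.ofMul.injective ?_
  rw [ofMul_inv, h1, ← PathCocycle.hurewicz_val_loop]
  -- The connecting paths do not contribute to the cocycle, so the image of `μ` has the value of the
  -- image of the boundary of `D`. This is minus the value of the flipped disk, which is a positive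
  -- meridian disk and so has the same value as `D`.
  change c.val _ = -c.val _
  rw [c.val_trans_trans_symm, Path.map_trans, Path.map_trans, ← Path.map_symm,
    c.val_trans_trans_symm, TwoKnot.val_flip_boundary D hHφ hφ c, F.val_boundary_eq c _ D]
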